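/- **Theorem (Asymptotic distribution for the Adaptive Lasso).** Fix $p$, $\beta^*\in\mathbb R^p$, $\sigma\ge 0$ and $\gamma>0$, and let $S=\{j:\beta^*_j\ne0\}$, $S^c=\{j:\beta^*_j=0\}$. For each $n$ let $X=X_n\in\mathbb R^{n\times p}$ be a deterministic matrix with rows $x_i^\top$ and let $y=X\beta^*+\varepsilon$, where $\varepsilon=\varepsilon_n\in\mathbb R^n$ has i.i.d. $\mathcal N(0,\sigma^2)$ entries. Assume that, as $n\to\infty$, $\frac1nX^\top X\to C$ with $C$ positive definite, and $\frac1n\max_i\|x_i\|_2^2\to0$. Let $m=m(n)$ be integers, positive for all large $n$, with $n/m\to r_0$ for some $r_0\in[0,\infty)$. Let $\tilde\beta=\tilde\beta_n$ be an initial estimator (a random vector in $\mathbb R^p$) that is independent of $\varepsilon_n$ and is such that $\sqrt m(\tilde\beta-\beta^*)$ converges in distribution to a random vector $z$ (in particular, $\tilde\beta$ is $\sqrt m$-consistent). Let $W\sim\mathcal N(0,\sigma^2C)$ be independent of $z$. For $\lambda_n\ge0$, let $\hat\beta_n$ be an Adaptive Lasso estimator, that is, a random vector with $$\hat\beta_n\in\operatorname*{argmin}_{\beta\in\mathbb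 R^p}\Big\{\frac1n\|y-X\beta\|_2^2+\frac{\lambda_n}{n}\sum_{j=1}^p\frac{|\beta_j|}{|\tilde\beta_j|^{\gamma}}\Big\}\quad\text{almost surely.}$$ Here and below, $1/0=\infty$ and $0\cdot\infty=0$ in the penalty terms; thus, if $\lambda_n>0$ and $\tilde\beta_j=0$, then $\beta_j=0$ is forced. Put $\mathcal U=\{u\in\mathbb R^p: u_j=0\text{ for all }j\in S^c\}$. Then the following hold as $n\to\infty$; in each case the minimizer in the limit exists and is unique (almost surely in (i) and (ii)). (i) If $\sqrt{m^\gamma/n}\,\lambda_n\to\lambda_1\in[0,\infty)$, and, in case $\lambda_1=0$, $P(z_j=0)=0$ for every $j\in S^c$, then $$\sqrt n(\hat\beta_n-\beta^*)\overset d\to\operatorname*{argmin}_{u\in\mathbb R^p}\Big\{u^\top Cu-2u^\top W+\sum_{j\in S^c}\frac{\lambda_1}{|z_j|^\gamma}|u_j|\Big\}.$$ (ii) If $\sqrt{m^\gamma/n}\,\lambda_n\to\infty$ and $\lambda_n/\sqrt n\to\lambda_0\in[0,\infty)$, then $$\sqrt n(\hat\beta_n-\beta^*)\overset d\to\operatorname*{argmin}_{u\in\mathcal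 U}\Big\{u^\top Cu-2u^\top W+\lambda_0\sum_{j\in S}\frac{\operatorname{sgn}(\beta^*_j)}{|\beta^*_j|^\gamma}u_j\Big\}.$$ (iii) If $\lambda_n/\sqrt n\to\infty$ and $\lambda_n/n\to0$, then $$\frac n{\lambda_n}(\hat\beta_n-\beta^*)\overset d\to\operatorname*{argmin}_{u\in\mathcal U}\Big\{u^\top Cu+\sum_{j\in S}\frac{\operatorname{sgn}(\beta^*_j)}{|\beta^*_j|^\gamma}u_j\Big\}.$$ -/

import Mathlib

open MeasureTheory ProbabilityTheory Filter Topology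
open scoped ENNReal NNReal Matrix

namespace AdaptiveLasso

noncomputable section

/-- The set `S` of active coordinates of the true parameter. -/
def activeSet {p : ℕ} (βs : EuclideanSpace ℝ (Fin p)) : Finset (Fin p) := {j | βs j ≠ 0}

/-- The residual sum of squares `‖y - X β‖₂²`. -/
def rss {n p : ℕ} (X : Matrix (Fin n) (Fin p) ℝ) (y : Fin n → ℝ)
    (β : EuclideanSpace ℝ (Fin p)) : ℝ :=
  ∑ i, (y i - (X *ᵥ β.ofLp) i) ^ 2

/-- The weight `1 / |b| ^ γ` as an extended nonnegative number: it equals `∞` at `b = 0`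
(when `γ > 0`), so that no junk value of a real division by zero enters. -/
def weight (γ b : ℝ) : ℝ≥0∞ := (ENNReal.ofReal |b| ^ γ)⁻¹

/-- The Adaptive Lasso objective
`(1/n) ‖y - X β‖₂² + (lam/n) ∑ j, |β j| / |βt j| ^ γ`, with initial estimate `βt` and
regularization parameter `lam ≥ 0`.  It takes values in `[0, ∞]`: for `lam > 0`, a coordinate
with `βt j = 0` has infinite weight and so forces `β j = 0` (with `∞ * 0 = 0`). -/
def objective {n p : ℕ} (X : Matrix (Fin n) (Fin p) ℝ) (y : Fin n → ℝ) (lam γ : ℝ)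
    (βt β : EuclideanSpace ℝ (Fin p)) : ℝ≥0∞ :=
  ENNReal.ofReal (1 / n * rss X y β)
    + ENNReal.ofReal (lam / n) * ∑ j, weight γ (βt j) * ENNReal.ofReal |β j|

/-- `x` is a minimizer of `f` over `s`. -/
def IsArgmin {α β : Type*} [Preorder β] (f : α → β) (s : Set α) (x : α) : Prop :=
  x ∈ s ∧ ∀ y ∈ s, f x ≤ f y

/-- `x` is the only minimizer of `f` over `s`. -/
def IsUniqueArgmin {α β : Type*} [Preorder β] (f : α → β) (s : Set α) (x : α) : Prop :=
  IsArgmin f s x ∧ ∀ y, IsArgmin f s y → y = x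

/-- The set `𝒰 = {u | u j = 0 for every inactive coordinate j}`. -/
def activeSubspace {p : ℕ} (βs : EuclideanSpace ℝ (Fin p)) : Set (EuclideanSpace ℝ (Fin p)) :=
  {u | ∀ j ∉ activeSet βs, u j = 0}

/-- `uᵀ C u - 2 uᵀ w`. -/
def quad {p : ℕ} (C : Matrix (Fin p) (Fin p) ℝ) (w u : EuclideanSpace ℝ (Fin p)) : ℝ :=
  u.ofLp ⬝ᵥ (C *ᵥ u.ofLp) - 2 * (u.ofLp ⬝ᵥ w.ofLp)

/-- `uᵀ C u - 2 uᵀ w + ∑ j ∈ Sᶜ, (lam₁ / |z j| ^ γ) |u j|`, with values in `(-∞, ∞]`. -/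
def limitSmall {p : ℕ} (C : Matrix (Fin p) (Fin p) ℝ) (βs : EuclideanSpace ℝ (Fin p))
    (lam₁ γ : ℝ) (w z u : EuclideanSpace ℝ (Fin p)) : EReal :=
  ((quad C w u : ℝ) : EReal)
    + ((∑ j ∈ (activeSet βs)ᶜ,
        ENNReal.ofReal lam₁ * weight γ (z j) * ENNReal.ofReal |u j| : ℝ≥0∞) : EReal)

/-- `∑ j ∈ S, (sgn (βs j) / |βs j| ^ γ) u j`. -/
def activeDrift {p : ℕ} (βs : EuclideanSpace ℝ (Fin p)) (γ : ℝ)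
    (u : EuclideanSpace ℝ (Fin p)) : ℝ :=
  ∑ j ∈ activeSet βs, Real.sign (βs j) / |βs j| ^ γ * u j

end

end AdaptiveLasso

/-! Substitute `β = βs + t • u`. Up to a constant and the factor `t ^ 2`, the Adaptive Lasso
objective becomes a quadratic form in `u` plus a penalty of strength `κ = lam / (n * t)`. On active
coordinates the penalty is an increment of `|·|` at a nonzero point, hence linear once `t` is small.
On inactive coordinates it is a weight in `[0, ∞]` times `|u j|`, and an infinite weight is a
constraint `u j = 0` (`isArgmin_penalized`).

Randomness enters only through the score `Xᵀ ε / √n` and the rescaled error of the initial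
estimator. The score is exactly Gaussian, so convergence of the Gram matrices gives its limit law;
independence upgrades the two marginal limits to a joint one. The rest is deterministic: when
matrix, linear term and weights converge, minimizers converge to the unique minimizer of the limit
problem, even if weights tend to `∞` (`tendsto_argmin`). Since the approximating minimizers need be
neither unique nor functions of the data, this is transferred to laws by a continuous mapping
theorem for relations (`tendstoInDistribution_of_relation`).

The three regimes are instances of `tendstoInDistribution_of_scaling`: they differ only in the step
`t` and in the limits of `κ`, of the noise factor `(√n * t)⁻¹` and of the inactive weights. -/

namespace AdaptiveLasso

/-! ### Existence, uniqueness and stability of minimizers of penalized quadratic forms. -/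

section Deterministic

variable {p : ℕ} {S : Finset (Fin p)} {C : Matrix (Fin p) (Fin p) ℝ}

/-- The quadratic form `uᵀ A u - 2 uᵀ w` plus a penalty `ρ j` for each coordinate `j ∈ S` and a
weighted absolute value for each coordinate `j ∉ S`, where infinite weights are ignored. -/
noncomputable def penalized (S : Finset (Fin p)) (A : Matrix (Fin p) (Fin p) ℝ)
    (w : EuclideanSpace ℝ (Fin p)) (ρ : Fin p → ℝ → ℝ) (c : Fin p → ℝ≥0∞)
    (u : EuclideanSpace ℝ (Fin p)) : ℝ :=
  quad A w u + ∑ j ∈ S, ρ j (u j) + ∑ j ∈ Sᶜ, (c j).toReal * |u j|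

/-- The points whose coordinates of infinite weight vanish. -/
def feasible (S : Finset (Fin p)) (c : Fin p → ℝ≥0∞) : Set (EuclideanSpace ℝ (Fin p)) :=
  {u | ∀ j ∉ S, c j = ∞ → u j = 0}

lemma continuous_quad :
    Continuous fun q : Matrix (Fin p) (Fin p) ℝ × EuclideanSpace ℝ (Fin p) ×
      EuclideanSpace ℝ (Fin p) => quad q.1 q.2.1 q.2.2 := by
  unfold quad
  have h1 : Continuous fun q : Matrix (Fin p) (Fin p) ℝ × EuclideanSpace ℝ (Fin p) ×
      EuclideanSpace ℝ (Fin p) => q.2.2.ofLp :=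
    (PiLp.continuous_ofLp 2 _).comp continuous_snd.snd
  have h2 : Continuous fun q : Matrix (Fin p) (Fin p) ℝ × EuclideanSpace ℝ (Fin p) ×
      EuclideanSpace ℝ (Fin p) => q.2.1.ofLp :=
    (PiLp.continuous_ofLp 2 _).comp continuous_snd.fst
  exact (h1.dotProduct (continuous_fst.matrix_mulVec h1)).sub ((h1.dotProduct h2).const_mul 2)

lemma quad_smul (A : Matrix (Fin p) (Fin p) ℝ) (r : ℝ) (u : EuclideanSpace ℝ (Fin p)) :
    quad A 0 (r • u) = r ^ 2 * quad A 0 u := by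
  simp [quad, Matrix.mulVec_smul]
  ring

lemma quad_eq_sub (A : Matrix (Fin p) (Fin p) ℝ) (w u : EuclideanSpace ℝ (Fin p)) :
    quad A w u = quad A 0 u - 2 * inner ℝ u w := by
  simp [quad, PiLp.inner_apply, dotProduct, mul_comm]

/-- The parallelogram identity: the defect `quad A 0 (u - v) / 4` is the strict convexity behind
uniqueness. -/
lemma quad_midpoint (A : Matrix (Fin p) (Fin p) ℝ) (w u v : EuclideanSpace ℝ (Fin p)) :
    quad A w ((1 / 2 : ℝ) • (u + v)) =
      (quad A w u + quad A w v) / 2 - quad A 0 (u - v) / 4 := by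
  simp [quad, Matrix.mulVec_smul, Matrix.mulVec_add, Matrix.mulVec_sub]
  ring

lemma quad_zero_pos (hC : C.PosDef) {u : EuclideanSpace ℝ (Fin p)} (hu : u ≠ 0) :
    0 < quad C 0 u := by
  have h : u.ofLp ≠ 0 := fun h => hu (by ext j; simp [h])
  simpa [quad] using hC.dotProduct_mulVec_pos h

/-- Positivity on the compact unit sphere gives a positive lower bound, compactness keeps it for all
`A` near `C`, and homogeneity extends it to every `u`. A single `κ` serves the whole neighbourhood.
-/
lemma eventually_le_quad (hC : C.PosDef) :
    ∃ κ > 0, ∀ᶠ A in 𝓝 C, ∀ u : EuclideanSpace ℝ (Fin p), κ * ‖u‖ ^ 2 ≤ quad A 0 u := by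
  have hcont : Continuous fun q : Matrix (Fin p) (Fin p) ℝ × EuclideanSpace ℝ (Fin p) =>
      quad q.1 0 q.2 :=
    continuous_quad.comp (continuous_fst.prodMk (continuous_const.prodMk continuous_snd))
  have hcpt := isCompact_sphere (0 : EuclideanSpace ℝ (Fin p)) 1
  obtain ⟨κ, hκ, hκC⟩ : ∃ κ > 0, ∀ u ∈ Metric.sphere (0 : EuclideanSpace ℝ (Fin p)) 1,
      κ < quad C 0 u := by
    -- The sphere is empty when `p = 0`.
    rcases (Metric.sphere (0 : EuclideanSpace ℝ (Fin p)) 1).eq_empty_or_nonempty with h | h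
    · exact ⟨1, one_pos, by simp [h]⟩
    · obtain ⟨v, hv, hmin⟩ := hcpt.exists_isMinOn h
        (hcont.comp (Continuous.prodMk_right C)).continuousOn
      have hv0 : v ≠ 0 := ne_zero_of_mem_unit_sphere (⟨v, hv⟩ : Metric.sphere _ 1)
      have := quad_zero_pos hC hv0
      refine ⟨quad C 0 v / 2, by positivity, fun u hu => ?_⟩
      have := hmin hu
      simp only [Set.mem_ofPred_eq, Function.comp_apply] at this
      linarith
  refine ⟨κ, hκ, ?_⟩
  have key := hcpt.eventually_forall_of_forall_eventually (x₀ := C)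
    (P := fun A u => κ < quad A 0 u)
    (fun u hu => hcont.continuousAt.eventually (lt_mem_nhds (hκC u hu)))
  filter_upwards [key] with A hA u
  rcases eq_or_ne u 0 with rfl | hu
  · simp [quad]
  · have h1 := hA (‖u‖⁻¹ • u) (by simp [norm_smul, hu])
    rw [quad_smul] at h1
    have hpos : 0 < ‖u‖ := norm_pos_iff.2 hu
    have h2 : κ * ‖u‖ ^ 2 ≤ (‖u‖⁻¹ ^ 2 * quad A 0 u) * ‖u‖ ^ 2 := by gcongr
    calc κ * ‖u‖ ^ 2 ≤ _ := h2
      _ = quad A 0 u := by field_simp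

/-- Coercivity with constants depending only on bounds for the data: Cauchy–Schwarz controls the
linear term, and each active penalty is at most `a * ‖u‖` in absolute value. -/
lemma le_quad_add_sum {A : Matrix (Fin p) (Fin p) ℝ} {w u : EuclideanSpace ℝ (Fin p)}
    {ρ : Fin p → ℝ → ℝ} {κ a B : ℝ} (ha : 0 ≤ a) (hA : κ * ‖u‖ ^ 2 ≤ quad A 0 u)
    (hw : ‖w‖ ≤ B) (hρ : ∀ j ∈ S, ∀ s, |ρ j s| ≤ a * |s|) :
    κ * ‖u‖ ^ 2 - (2 * B + S.card * a) * ‖u‖ ≤ quad A w u + ∑ j ∈ S, ρ j (u j) := by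
  have h1 : inner ℝ u w ≤ ‖u‖ * B :=
    (real_inner_le_norm u w).trans (by gcongr)
  have h2 : ∑ j ∈ S, (-(a * ‖u‖)) ≤ ∑ j ∈ S, ρ j (u j) := by
    refine Finset.sum_le_sum fun j hj => ?_
    have h3 := (abs_le.1 (hρ j hj (u j))).1
    have h4 : |u j| ≤ ‖u‖ := PiLp.norm_apply_le u j
    have : a * |u j| ≤ a * ‖u‖ := by gcongr
    linarith
  rw [Finset.sum_const, nsmul_eq_mul] at h2
  rw [quad_eq_sub]
  linarith

lemma penalized_zero {A : Matrix (Fin p) (Fin p) ℝ} {w : EuclideanSpace ℝ (Fin p)}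
    {ρ : Fin p → ℝ → ℝ} {c : Fin p → ℝ≥0∞} (hρ : ∀ j ∈ S, ρ j 0 = 0) :
    penalized S A w ρ c 0 = 0 := by
  simp [penalized, quad, Finset.sum_eq_zero hρ]

lemma zero_mem_feasible (c : Fin p → ℝ≥0∞) : (0 : EuclideanSpace ℝ (Fin p)) ∈ feasible S c :=
  fun _ _ _ => rfl

lemma isClosed_feasible (c : Fin p → ℝ≥0∞) : IsClosed (feasible S c) := by
  simp only [feasible, Set.ofPred_forall]
  refine isClosed_iInter fun j => isClosed_iInter fun _ => isClosed_iInter fun _ => ?_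
  exact isClosed_eq (by fun_prop) continuous_const

lemma continuous_penalized (A : Matrix (Fin p) (Fin p) ℝ) (w : EuclideanSpace ℝ (Fin p))
    (α : Fin p → ℝ) (c : Fin p → ℝ≥0∞) :
    Continuous (penalized S A w (fun j s => α j * s) c) := by
  have h : Continuous (quad A w) :=
    continuous_quad.comp (continuous_const.prodMk (continuous_const.prodMk continuous_id))
  unfold penalized
  fun_prop

/-- The limit problem has exactly one minimizer. -/
theorem exists_isUniqueArgmin (hC : C.PosDef) (w : EuclideanSpace ℝ (Fin p)) (α : Fin p → ℝ)
    (c : Fin p → ℝ≥0∞) :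
    ∃ u, IsUniqueArgmin (penalized S C w (fun j s => α j * s) c) (feasible S c) u := by
  obtain ⟨κ, hκ, hev⟩ := eventually_le_quad hC
  have hquad := hev.self_of_nhds
  set f := penalized S C w (fun j s => α j * s) c with hf
  set a := ∑ j, |α j| with ha
  set M := 2 * ‖w‖ + S.card * a with hM
  have ha0 : 0 ≤ a := Finset.sum_nonneg fun _ _ => abs_nonneg _
  have hlow : ∀ u, κ * ‖u‖ ^ 2 - M * ‖u‖ ≤ f u := fun u => by
    have h := le_quad_add_sum (S := S) (ρ := fun j s => α j * s) ha0 (hquad u) (le_refl ‖w‖)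
      (fun j _ s => by
        rw [abs_mul]
        gcongr
        exact Finset.single_le_sum (f := fun j => |α j|) (fun _ _ => abs_nonneg _)
          (Finset.mem_univ j))
    have : 0 ≤ ∑ j ∈ Sᶜ, (c j).toReal * |u j| := by positivity
    simp only [hf, penalized]
    linarith
  -- Once `‖v‖ ≥ M / κ`, the lower bound is nonnegative, so `v` does no better than the feasible
  -- point `0`.
  obtain ⟨u, hu, hmin⟩ := ContinuousOn.exists_isMinOn' (continuous_penalized C w α c).continuousOn
    (isClosed_feasible (S := S) c) (zero_mem_feasible c) (by
      refine Filter.Eventually.filter_mono inf_le_left ?_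
      filter_upwards [(tendsto_norm_cocompact_atTop (E := EuclideanSpace ℝ (Fin p))).eventually_ge_atTop
        (M / κ)] with v hv
      rw [penalized_zero (by simp)]
      refine le_trans ?_ (hlow v)
      rw [div_le_iff₀ hκ] at hv
      nlinarith [norm_nonneg v])
  refine ⟨u, ⟨hu, fun v hv => hmin hv⟩, fun v hv => ?_⟩
  by_contra hne
  have hmem : (1 / 2 : ℝ) • (u + v) ∈ feasible S c := fun j hj hcj => by
    simp [hu j hj hcj, hv.1 j hj hcj]
  have h1 : f u ≤ f ((1 / 2 : ℝ) • (u + v)) := hmin hmem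
  have h2 : f v ≤ f u := hv.2 u hu
  have h3 : 0 < quad C 0 (u - v) := quad_zero_pos hC (sub_ne_zero.2 (Ne.symm hne))
  have h4 : f ((1 / 2 : ℝ) • (u + v)) ≤ (f u + f v) / 2 - quad C 0 (u - v) / 4 := by
    have e1 : ∑ j ∈ S, α j * ((1 / 2 : ℝ) • (u + v)) j =
        (∑ j ∈ S, α j * u j + ∑ j ∈ S, α j * v j) / 2 := by
      rw [← Finset.sum_add_distrib, Finset.sum_div]
      refine Finset.sum_congr rfl fun j _ => ?_
      simp
      ring
    have e2 : ∑ j ∈ Sᶜ, (c j).toReal * |((1 / 2 : ℝ) • (u + v)) j| ≤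
        (∑ j ∈ Sᶜ, (c j).toReal * |u j| + ∑ j ∈ Sᶜ, (c j).toReal * |v j|) / 2 := by
      rw [← Finset.sum_add_distrib, Finset.sum_div]
      refine Finset.sum_le_sum fun j _ => ?_
      have : |((1 / 2 : ℝ) • (u + v)) j| ≤ (|u j| + |v j|) / 2 := by
        have h : ((1 / 2 : ℝ) • (u + v)) j = (u j + v j) / 2 := by
          simp
          ring
        rw [h, abs_div, abs_two]
        gcongr
        exact abs_add_le _ _
      calc _ ≤ (c j).toReal * ((|u j| + |v j|) / 2) := by gcongr
        _ = _ := by ring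
    simp only [hf, penalized, quad_midpoint, e1]
    linarith
  linarith

lemma tendsto_apply_of_tendsto {ι : Type*} {l : Filter ι} {y : ι → EuclideanSpace ℝ (Fin p)}
    {y₀ : EuclideanSpace ℝ (Fin p)} (hy : Tendsto y l (𝓝 y₀)) (j : Fin p) :
    Tendsto (fun i => y i j) l (𝓝 (y₀ j)) := by
  have h : Continuous fun x : EuclideanSpace ℝ (Fin p) => x j := by fun_prop
  exact (h.tendsto y₀).comp hy

lemma tendsto_quad {ι : Type*} {l : Filter ι} {A : ι → Matrix (Fin p) (Fin p) ℝ}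
    {w y : ι → EuclideanSpace ℝ (Fin p)} {w₀ y₀ : EuclideanSpace ℝ (Fin p)}
    (hA : Tendsto A l (𝓝 C)) (hw : Tendsto w l (𝓝 w₀)) (hy : Tendsto y l (𝓝 y₀)) :
    Tendsto (fun i => quad (A i) (w i) (y i)) l (𝓝 (quad C w₀ y₀)) := by
  have h := continuous_quad.tendsto (C, w₀, y₀)
  rw [nhds_prod_eq, nhds_prod_eq] at h
  have h' : Tendsto (fun i => (A i, w i, y i)) l (𝓝 C ×ˢ 𝓝 w₀ ×ˢ 𝓝 y₀) :=
    hA.prodMk (hw.prodMk hy)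
  have h'' := h.comp h'
  simpa only [Function.comp_def] using h''

/-- The joint filter in `hρ` expresses continuous convergence, which allows evaluation along moving
points. The weighted sum is restricted to `T` because `ENNReal.toReal` is discontinuous at `∞`. -/
lemma tendsto_quad_add_sum {ι : Type*} {l : Filter ι} {A : ι → Matrix (Fin p) (Fin p) ℝ}
    {w : ι → EuclideanSpace ℝ (Fin p)} {ρ : ι → Fin p → ℝ → ℝ} {c : ι → Fin p → ℝ≥0∞}
    {y : ι → EuclideanSpace ℝ (Fin p)} {w₀ y₀ : EuclideanSpace ℝ (Fin p)} {α : Fin p → ℝ}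
    {c₀ : Fin p → ℝ≥0∞} {T : Finset (Fin p)} (hA : Tendsto A l (𝓝 C)) (hw : Tendsto w l (𝓝 w₀))
    (hc : ∀ j ∈ T, Tendsto (fun i => c i j) l (𝓝 (c₀ j))) (hT : ∀ j ∈ T, c₀ j ≠ ∞)
    (hρ : ∀ j ∈ S, ∀ s, Tendsto (fun q : ι × ℝ => ρ q.1 j q.2) (l ×ˢ 𝓝 s) (𝓝 (α j * s)))
    (hy : Tendsto y l (𝓝 y₀)) :
    Tendsto (fun i => quad (A i) (w i) (y i) + ∑ j ∈ S, ρ i j (y i j) +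
      ∑ j ∈ T, (c i j).toReal * |y i j|) l
      (𝓝 (quad C w₀ y₀ + ∑ j ∈ S, α j * y₀ j + ∑ j ∈ T, (c₀ j).toReal * |y₀ j|)) := by
  have hyj : ∀ j, Tendsto (fun i => y i j) l (𝓝 (y₀ j)) := tendsto_apply_of_tendsto hy
  have h1 := tendsto_quad hA hw hy
  have h2 : ∀ j ∈ S, Tendsto (fun i => ρ i j (y i j)) l (𝓝 (α j * y₀ j)) := fun j hj => by
    have h : Tendsto (fun i => (i, y i j)) l (l ×ˢ 𝓝 (y₀ j)) := tendsto_id.prodMk (hyj j)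
    exact Tendsto.comp (hρ j hj (y₀ j)) h
  have h3 : ∀ j ∈ T, Tendsto (fun i => (c i j).toReal * |y i j|) l
      (𝓝 ((c₀ j).toReal * |y₀ j|)) := fun j hj => by
    have h : Tendsto (fun i => (c i j).toReal) l (𝓝 (c₀ j).toReal) :=
      (ENNReal.tendsto_toReal (hT j hj)).comp (hc j hj)
    exact h.mul (hyj j).abs
  have h4 := tendsto_finsetSum S h2
  have h5 := tendsto_finsetSum T h3
  exact (h1.add h4).add h5

/-- Stability of minimizers: if the data of the problems converge, the limit problem having a
positive definite quadratic form and linear penalties on `S`, then the minimizers converge. -/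
theorem tendsto_argmin {ι : Type*} {l : Filter ι} {A : ι → Matrix (Fin p) (Fin p) ℝ}
    {w : ι → EuclideanSpace ℝ (Fin p)} {ρ : ι → Fin p → ℝ → ℝ} {c : ι → Fin p → ℝ≥0∞}
    {u : ι → EuclideanSpace ℝ (Fin p)} {w₀ u₀ : EuclideanSpace ℝ (Fin p)} {α : Fin p → ℝ}
    {c₀ : Fin p → ℝ≥0∞} (hC : C.PosDef) (hA : Tendsto A l (𝓝 C)) (hw : Tendsto w l (𝓝 w₀))
    (hc : ∀ j ∉ S, Tendsto (fun i => c i j) l (𝓝 (c₀ j))) {a : ℝ}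
    (hρa : ∀ᶠ i in l, ∀ j ∈ S, ∀ s, |ρ i j s| ≤ a * |s|)
    (hρ : ∀ j ∈ S, ∀ s, Tendsto (fun q : ι × ℝ => ρ q.1 j q.2) (l ×ˢ 𝓝 s) (𝓝 (α j * s)))
    (hu : ∀ᶠ i in l, IsArgmin (penalized S (A i) (w i) (ρ i) (c i)) (feasible S (c i)) (u i))
    (hu₀ : IsUniqueArgmin (penalized S C w₀ (fun j s => α j * s) c₀) (feasible S c₀) u₀) :
    Tendsto u l (𝓝 u₀) := by
  obtain ⟨κ, hκ, hev⟩ := eventually_le_quad hC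
  have hquad := hA.eventually hev
  wlog ha : 0 ≤ a generalizing a
  · refine this (a := |a|) ?_ (abs_nonneg a)
    filter_upwards [hρa] with i hi j hj s
    exact (hi j hj s).trans (by gcongr; exact le_abs_self a)
  set B := ‖w₀‖ + 1
  have hwB : ∀ᶠ i in l, ‖w i‖ ≤ B := (hw.norm.eventually_lt_const (by simp [B])).mono fun _ h => h.le
  set M := 2 * B + S.card * a with hM
  have hM0 : 0 ≤ M := by positivity
  -- Compare with the feasible point `0`, whose value is `0`; coercivity then bounds `u i`.
  have hbasic : ∀ᶠ i in l, penalized S (A i) (w i) (ρ i) (c i) (u i) ≤ 0 ∧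
      κ * ‖u i‖ ^ 2 - M * ‖u i‖ ≤ quad (A i) (w i) (u i) + ∑ j ∈ S, ρ i j (u i j) := by
    filter_upwards [hquad, hwB, hρa, hu] with i h1 h2 h3 h4
    refine ⟨?_, le_quad_add_sum ha (h1 _) h2 h3⟩
    have := h4.2 0 (zero_mem_feasible _)
    rwa [penalized_zero fun j hj => by simpa using h3 j hj 0] at this
  have hpen : ∀ i, 0 ≤ ∑ j ∈ Sᶜ, (c i j).toReal * |u i j| := fun i => by positivity
  have hbdd : ∀ᶠ i in l, ‖u i‖ ≤ M / κ := by
    filter_upwards [hbasic] with i ⟨h1, h2⟩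
    rw [le_div_iff₀ hκ]
    by_contra! h
    have h3 := hpen i
    have h4 : 0 < ‖u i‖ := by
      rcases (norm_nonneg (u i)).lt_or_eq with h0 | h0
      · exact h0
      · rw [← h0] at h; linarith
    simp only [penalized] at h1
    nlinarith
  -- The bound is stated in `ℝ≥0∞` to cover infinite weights, where feasibility makes the product `∞
  -- * 0 = 0`. In the limit it forces a coordinate to vanish wherever the limit weight is `∞`.
  have hterm : ∀ᶠ i in l, ∀ j ∉ S, c i j * ENNReal.ofReal |u i j| ≤ ENNReal.ofReal (M * (M / κ)) := by
    filter_upwards [hbasic, hbdd, hu] with i ⟨h1, h2⟩ h3 h4 j hj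
    have h5 : (c i j).toReal * |u i j| ≤ ∑ j ∈ Sᶜ, (c i j).toReal * |u i j| :=
      Finset.single_le_sum (f := fun j => (c i j).toReal * |u i j|) (fun _ _ => by positivity)
        (Finset.mem_compl.2 hj)
    have h6 : M * ‖u i‖ ≤ M * (M / κ) := by gcongr
    have h7 : 0 ≤ κ * ‖u i‖ ^ 2 := by positivity
    by_cases hcj : c i j = ∞
    · simp [h4.1 j hj hcj]
    · rw [← ENNReal.ofReal_toReal hcj, ← ENNReal.ofReal_mul ENNReal.toReal_nonneg]
      apply ENNReal.ofReal_le_ofReal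
      simp only [penalized] at h1
      linarith
  -- By compactness it suffices that every cluster point minimizes the limit problem. Ultrafilters
  -- replace subsequences, as `l` is arbitrary.
  refine (isCompact_closedBall (0 : EuclideanSpace ℝ (Fin p)) (M / κ)).tendsto_nhds_of_unique_mapClusterPt
    (by simpa using hbdd) fun x _ hx => hu₀.2 x ?_
  obtain ⟨U, hUl, hUx⟩ := mapClusterPt_iff_ultrafilter.1 hx
  have hcoord : ∀ j, Tendsto (fun i => u i j) U (𝓝 (x j)) := tendsto_apply_of_tendsto hUx
  have hxfeas : x ∈ feasible S c₀ := fun j hj hcj => by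
    by_contra hxj
    have h1 : Tendsto (fun i => c i j * ENNReal.ofReal |u i j|) U
        (𝓝 (c₀ j * ENNReal.ofReal |x j|)) :=
      ENNReal.Tendsto.mul ((hc j hj).mono_left hUl) (Or.inr ENNReal.ofReal_ne_top)
        (ENNReal.tendsto_ofReal (hcoord j).abs) (Or.inl (by simpa using hxj))
    have h2 := le_of_tendsto h1 ((hterm.filter_mono hUl).mono fun i h => h j hj)
    rw [hcj, ENNReal.top_mul (by simpa using hxj)] at h2
    exact absurd h2 (by simp)
  refine ⟨hxfeas, fun v hv => ?_⟩
  set T : Finset (Fin p) := {j ∈ Sᶜ | c₀ j ≠ ∞} with hT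
  have hT_eq : ∀ y, penalized S C w₀ (fun j s => α j * s) c₀ y =
      quad C w₀ y + ∑ j ∈ S, α j * y j + ∑ j ∈ T, (c₀ j).toReal * |y j| := fun y => by
    simp only [penalized]
    congr 1
    refine (Finset.sum_subset (Finset.filter_subset _ _) fun j hj hjT => ?_).symm
    have : c₀ j = ∞ := by_contra fun h => hjT (Finset.mem_filter.2 ⟨hj, h⟩)
    simp [this]
  have hTc : ∀ j ∈ T, j ∉ S ∧ c₀ j ≠ ∞ := fun j hj => by simpa [hT] using hj
  have hlim : ∀ {y : ι → EuclideanSpace ℝ (Fin p)} {y₀ : EuclideanSpace ℝ (Fin p)},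
      Tendsto y U (𝓝 y₀) → _ := fun hy =>
    tendsto_quad_add_sum (hA.mono_left hUl) (hw.mono_left hUl)
      (fun j hj => (hc j (hTc j hj).1).mono_left hUl) (fun j hj => (hTc j hj).2)
      (fun j hj s => (hρ j hj s).mono_left (Filter.prod_mono_left _ hUl)) hy
  rw [hT_eq, hT_eq]
  -- The competitor `v` stays fixed: it vanishes where the limit weight is infinite, and the weights
  -- in `T` are eventually finite, so `v` is eventually feasible. Dropping the terms outside `T`
  -- only decreases the value at `u i` and does not change the value at `v`.
  refine le_of_tendsto_of_tendsto (hlim hUx) (hlim tendsto_const_nhds) ?_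
  have hfin : ∀ᶠ i in l, ∀ j ∈ T, c i j ≠ ∞ := by
    rw [Filter.eventually_all_finset]
    intro j hj
    exact (hc j (hTc j hj).1).eventually_ne (hTc j hj).2
  filter_upwards [hu.filter_mono hUl, hfin.filter_mono hUl] with i hi hci
  have hvi : v ∈ feasible S (c i) := fun j hj hcj => by
    by_contra hvj
    exact hci j (Finset.mem_filter.2 ⟨Finset.mem_compl.2 hj, fun h => hvj (hv j hj h)⟩) hcj
  have h1 := hi.2 v hvi
  have h2 : ∑ j ∈ T, (c i j).toReal * |u i j| ≤ ∑ j ∈ Sᶜ, (c i j).toReal * |u i j| :=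
    Finset.sum_le_sum_of_subset_of_nonneg (Finset.filter_subset _ _) fun _ _ _ => by positivity
  have h3 : ∑ j ∈ T, (c i j).toReal * |v j| = ∑ j ∈ Sᶜ, (c i j).toReal * |v j| := by
    refine Finset.sum_subset (Finset.filter_subset _ _) fun j hj hjT => ?_
    have : c₀ j = ∞ := by_contra fun h => hjT (Finset.mem_filter.2 ⟨hj, h⟩)
    simp [hv j (Finset.mem_compl.1 hj) this]
  simp only [penalized] at h1
  linarith

end Deterministic


/-! ### Convergence in distribution: relations, independent pairs and the Gaussian score. -/

section Probability

/-- Extended continuous mapping theorem for relations: if `X n → Z` in distribution, `Y n` is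
related to `X n` by `R n`, and almost surely any point related by `R n` to a point near `Z` is
near `U` for large `n`, then `Y n → U` in distribution. -/
theorem tendstoInDistribution_of_relation {E F Ω' : Type*} {Ω : ℕ → Type*}
    [∀ n, MeasurableSpace (Ω n)] {P : (n : ℕ) → Measure (Ω n)} [∀ n, IsProbabilityMeasure (P n)]
    [MeasurableSpace Ω'] {Q : Measure Ω'} [IsProbabilityMeasure Q]
    [TopologicalSpace E] [MeasurableSpace E] [OpensMeasurableSpace E] [HasOuterApproxClosed E]
    [TopologicalSpace F] [MeasurableSpace F] [OpensMeasurableSpace F]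
    {X : (n : ℕ) → Ω n → E} {Z : Ω' → E} {Y : (n : ℕ) → Ω n → F} {U : Ω' → F}
    (hX : TendstoInDistribution X atTop Z P Q) (hY : ∀ n, AEMeasurable (Y n) (P n))
    (hU : AEMeasurable U Q) (R : ℕ → E → F → Prop)
    (hXY : ∀ᶠ n in atTop, ∀ᵐ ω ∂(P n), R n (X n ω) (Y n ω))
    (hR : ∀ᵐ ω ∂Q, ∀ V ∈ 𝓝 (U ω), ∀ᶠ q in atTop ×ˢ 𝓝 (Z ω), ∀ y, R q.1 q.2 y → y ∈ V) :
    TendstoInDistribution Y atTop U P Q := by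
  refine ⟨hY, hU, tendsto_of_forall_isClosed_limsup_le' fun K hK => ?_⟩
  -- Taking closures makes the sets measurable without any assumption on `R` and lets the
  -- portmanteau inequality apply for each fixed `k`. The sets decrease, so continuity from above
  -- then gives their intersection.
  set G : ℕ → Set E := fun k => closure (⋃ n ≥ k, {x | ∃ y ∈ K, R n x y}) with hG
  have hGanti : Antitone G := fun a b hab => closure_mono <|
    Set.biUnion_subset_biUnion_left fun n hn => le_trans hab hn
  have hmeas : ∀ k, MeasurableSet (G k) := fun k => isClosed_closure.measurableSet
  have h1 : ∀ k, limsup (fun n => (P n).map (Y n) K) atTop ≤ Q.map Z (G k) := fun k => by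
    have hcl := ProbabilityMeasure.limsup_measure_closed_le_of_tendsto hX.tendsto
      (F := G k) isClosed_closure
    refine le_trans (limsup_le_limsup ?_) hcl
    filter_upwards [hXY, eventually_ge_atTop k] with n hn hnk
    change (P n).map (Y n) K ≤ (P n).map (X n) (G k)
    rw [Measure.map_apply_of_aemeasurable (hY n) hK.measurableSet,
      Measure.map_apply_of_aemeasurable (hX.forall_aemeasurable n) (hmeas k)]
    refine measure_mono_ae ?_
    filter_upwards [hn] with ω hω hωK
    exact subset_closure (Set.mem_biUnion hnk ⟨Y n ω, hωK, hω⟩)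
  have h2 : Tendsto (fun k => Q.map Z (G k)) atTop (𝓝 (Q.map Z (⋂ k, G k))) :=
    tendsto_measure_iInter_atTop (fun k => (hmeas k).nullMeasurableSet) hGanti
      ⟨0, by
        have := Measure.isProbabilityMeasure_map hX.aemeasurable_limit
        exact measure_ne_top _ _⟩
  refine (ge_of_tendsto' h2 h1).trans ?_
  change Q.map Z (⋂ k, G k) ≤ Q.map U K
  rw [Measure.map_apply_of_aemeasurable hU hK.measurableSet,
    Measure.map_apply_of_aemeasurable hX.aemeasurable_limit (MeasurableSet.iInter hmeas)]
  refine measure_mono_ae ?_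
  filter_upwards [hR] with ω hω hωG
  -- If `U ω ∉ K`, the hypothesis with `V = Kᶜ` excludes points of `K` related to points near `Z ω`
  -- for large `n`, whereas `Z ω ∈ G k` for every `k` supplies one.
  by_contra hωK
  obtain ⟨s, hs, t, ht, hst⟩ := Filter.mem_prod_iff.1 (hω Kᶜ (hK.isOpen_compl.mem_nhds hωK))
  obtain ⟨k, hk⟩ := Filter.mem_atTop_sets.1 hs
  obtain ⟨x, hxt, hx⟩ := mem_closure_iff_nhds.1 (Set.mem_iInter.1 hωG k) t ht
  obtain ⟨n, hn, y, hyK, hy⟩ := Set.mem_iUnion₂.1 hx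
  exact hst (Set.mk_mem_prod (hk n hn) hxt) y hy hyK

/-- Independent sequences that converge in distribution converge jointly to the independent
coupling of their limits. -/
theorem tendstoInDistribution_prodMk_of_indepFun {E F Ω' : Type*} {Ω : ℕ → Type*}
    [∀ n, MeasurableSpace (Ω n)] {P : (n : ℕ) → Measure (Ω n)} [∀ n, IsProbabilityMeasure (P n)]
    [MeasurableSpace Ω'] {Q : Measure Ω'} [IsProbabilityMeasure Q]
    [TopologicalSpace E] [MeasurableSpace E] [OpensMeasurableSpace E]
    [SecondCountableTopology E] [TopologicalSpace.PseudoMetrizableSpace E]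
    [TopologicalSpace F] [MeasurableSpace F] [OpensMeasurableSpace F]
    [SecondCountableTopology F] [TopologicalSpace.PseudoMetrizableSpace F]
    {X : (n : ℕ) → Ω n → E} {Z : Ω' → E} {Y : (n : ℕ) → Ω n → F} {U : Ω' → F}
    (hX : TendstoInDistribution X atTop Z P Q) (hY : TendstoInDistribution Y atTop U P Q)
    (hXY : ∀ n, IndepFun (X n) (Y n) (P n)) (hZU : IndepFun Z U Q) :
    TendstoInDistribution (fun n ω => (X n ω, Y n ω)) atTop (fun ω => (Z ω, U ω)) P Q := by
  refine ⟨fun n => (hX.forall_aemeasurable n).prodMk (hY.forall_aemeasurable n),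
    hX.aemeasurable_limit.prodMk hY.aemeasurable_limit, ?_⟩
  have h := (ProbabilityMeasure.continuous_prod.tendsto _).comp (hX.tendsto.prodMk_nhds hY.tendsto)
  have hlim : Q.map (fun ω => (Z ω, U ω)) = (Q.map Z).prod (Q.map U) :=
    (indepFun_iff_map_prod_eq_prod_map_map hX.aemeasurable_limit hY.aemeasurable_limit).1 hZU
  have hn : ∀ n, (P n).map (fun ω => (X n ω, Y n ω)) = ((P n).map (X n)).prod ((P n).map (Y n)) :=
    fun n => (indepFun_iff_map_prod_eq_prod_map_map (hX.forall_aemeasurable n)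
      (hY.forall_aemeasurable n)).1 (hXY n)
  refine (h.congr fun n => Subtype.ext (hn n).symm).trans (le_of_eq (congrArg 𝓝 ?_))
  exact Subtype.ext hlim.symm

variable {p : ℕ}

/-- The characteristic function of a linear image of i.i.d. centred Gaussian noise. -/
lemma charFun_map_mulVec_noise {n : ℕ} {Ω : Type*} [MeasurableSpace Ω] {P : Measure Ω}
    [IsProbabilityMeasure P]
    {σ : ℝ≥0} {ε : Ω → Fin n → ℝ} (hind : iIndepFun (fun i ω => ε ω i) P)
    (hlaw : ∀ i, HasLaw (fun ω => ε ω i) (gaussianReal 0 (σ ^ 2)) P)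
    (B : Matrix (Fin p) (Fin n) ℝ) (t : EuclideanSpace ℝ (Fin p)) :
    charFun (P.map fun ω => WithLp.toLp 2 (B *ᵥ ε ω)) t =
      Complex.exp (-((σ ^ 2 * (t.ofLp ⬝ᵥ (B * Bᵀ) *ᵥ t.ofLp) : ℝ) : ℂ) / 2) := by
  have hm : AEMeasurable (fun ω => WithLp.toLp 2 (ε ω)) P :=
    (WithLp.measurable_toLp 2 _).comp_aemeasurable
      (aemeasurable_pi_lambda _ fun i => (hlaw i).aemeasurable)
  have hB : Measurable fun x : EuclideanSpace ℝ (Fin n) => WithLp.toLp 2 (B *ᵥ x.ofLp) := by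
    refine (WithLp.measurable_toLp 2 _).comp ?_
    exact (Continuous.matrix_mulVec continuous_const (PiLp.continuous_ofLp 2 _)).measurable
  have hmB : AEMeasurable (fun ω => WithLp.toLp 2 (B *ᵥ ε ω)) P := hB.comp_aemeasurable hm
  set s : EuclideanSpace ℝ (Fin n) := WithLp.toLp 2 (Bᵀ *ᵥ t.ofLp)
  have hinner : ∀ ω, inner ℝ (WithLp.toLp 2 (B *ᵥ ε ω)) t = inner ℝ (WithLp.toLp 2 (ε ω)) s := by
    intro ω
    simp only [EuclideanSpace.inner_eq_star_dotProduct, star_trivial, s]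
    rw [Matrix.dotProduct_mulVec, Matrix.mulVec_transpose]
  have h1 : charFun (P.map fun ω => WithLp.toLp 2 (B *ᵥ ε ω)) t =
      charFun (P.map fun ω => WithLp.toLp 2 (ε ω)) s := by
    rw [charFun_apply, charFun_apply, integral_map hmB (by fun_prop), integral_map hm (by fun_prop)]
    simp only [hinner]
  have h3 := (iIndepFun_iff_charFun_pi (P := P) (X := fun i ω => ε ω i)
    (fun i => (hlaw i).aemeasurable)).1 hind s
  rw [h1, h3]
  simp_rw [(hlaw _).map_eq, charFun_gaussianReal]
  rw [← Complex.exp_sum]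
  have h2 : t.ofLp ⬝ᵥ (B * Bᵀ) *ᵥ t.ofLp = ∑ i, s i ^ 2 := by
    rw [← Matrix.mulVec_mulVec, Matrix.dotProduct_mulVec, ← Matrix.mulVec_transpose]
    simp [dotProduct, s, sq]
  rw [h2]
  push_cast
  rw [Finset.mul_sum, ← Finset.sum_neg_distrib, Finset.sum_div]
  congr 1
  refine Finset.sum_congr rfl fun i _ => ?_
  simp
  ring

/-- The rescaled score `Xᵀ ε / √n` converges in distribution to `N(0, σ² C)`. -/
theorem tendstoInDistribution_score {σ : ℝ≥0} {X : (n : ℕ) → Matrix (Fin n) (Fin p) ℝ}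
    {C : Matrix (Fin p) (Fin p) ℝ} (hC : C.PosDef)
    (hXC : Tendsto (fun n : ℕ => (1 / (n : ℝ)) • ((X n)ᵀ * X n)) atTop (𝓝 C))
    {Ω : ℕ → Type*} [∀ n, MeasurableSpace (Ω n)] {P : (n : ℕ) → Measure (Ω n)}
    [∀ n, IsProbabilityMeasure (P n)] {ε : (n : ℕ) → Ω n → Fin n → ℝ}
    (hε_indep : ∀ n : ℕ, iIndepFun (fun i ω => ε n ω i) (P n))
    (hε_law : ∀ n i, HasLaw (fun ω => ε n ω i) (gaussianReal 0 (σ ^ 2)) (P n))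
    {Ω' : Type*} [MeasurableSpace Ω'] {Q : Measure Ω'} [IsProbabilityMeasure Q]
    {W : Ω' → EuclideanSpace ℝ (Fin p)}
    (hW : HasLaw W (multivariateGaussian 0 (((σ : ℝ) ^ 2) • C)) Q) :
    TendstoInDistribution
      (fun (n : ℕ) ω => WithLp.toLp 2 (((√(n : ℝ))⁻¹ • (X n)ᵀ) *ᵥ ε n ω)) atTop W P Q := by
  have hm : ∀ n : ℕ, AEMeasurable (fun ω => WithLp.toLp 2 (((√(n : ℝ))⁻¹ • (X n)ᵀ) *ᵥ ε n ω)) (P n) := by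
    intro n
    have h : Continuous fun x : Fin n → ℝ => WithLp.toLp 2 (((√(n : ℝ))⁻¹ • (X n)ᵀ) *ᵥ x) :=
      (PiLp.continuous_toLp 2 _).comp (Continuous.matrix_mulVec continuous_const continuous_id)
    exact h.measurable.comp_aemeasurable
      (aemeasurable_pi_lambda _ fun i => (hε_law n i).aemeasurable)
  -- Each characteristic function is exactly Gaussian and depends continuously on the normalized
  -- Gram matrix, so no central limit theorem is needed.
  refine ⟨hm, hW.aemeasurable, ProbabilityMeasure.tendsto_iff_tendsto_charFun.2 fun t => ?_⟩
  have hpsd : (((σ : ℝ) ^ 2) • C).PosSemidef := hC.posSemidef.smul (sq_nonneg _)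
  have h1 : charFun (Q.map W) t =
      Complex.exp (-((σ ^ 2 * (t.ofLp ⬝ᵥ C *ᵥ t.ofLp) : ℝ) : ℂ) / 2) := by
    rw [hW.map_eq, charFun_multivariateGaussian hpsd]
    simp [Matrix.smul_mulVec]
    ring_nf
  have h2 : ∀ n : ℕ, charFun ((P n).map fun ω => WithLp.toLp 2 (((√(n : ℝ))⁻¹ • (X n)ᵀ) *ᵥ ε n ω)) t =
      Complex.exp (-((σ ^ 2 * (t.ofLp ⬝ᵥ ((1 / (n : ℝ)) • ((X n)ᵀ * X n)) *ᵥ t.ofLp) : ℝ) : ℂ) / 2) := by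
    intro n
    rw [charFun_map_mulVec_noise (hε_indep n) (hε_law n)]
    have : (√(n : ℝ))⁻¹ • (X n)ᵀ * ((√(n : ℝ))⁻¹ • (X n)ᵀ)ᵀ = (1 / (n : ℝ)) • ((X n)ᵀ * X n) := by
      rw [Matrix.transpose_smul, Matrix.transpose_transpose, Matrix.smul_mul, Matrix.mul_smul,
        smul_smul, ← mul_inv, Real.mul_self_sqrt (Nat.cast_nonneg n), one_div]
    rw [this]
  change Tendsto (fun n : ℕ => charFun ((P n).map _) t) atTop (𝓝 (charFun (Q.map W) t))
  rw [h1]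
  simp_rw [h2]
  have hcont : Continuous fun A : Matrix (Fin p) (Fin p) ℝ =>
      Complex.exp (-((σ ^ 2 * (t.ofLp ⬝ᵥ A *ᵥ t.ofLp) : ℝ) : ℂ) / 2) := by
    have : Continuous fun A : Matrix (Fin p) (Fin p) ℝ => t.ofLp ⬝ᵥ A *ᵥ t.ofLp :=
      continuous_const.dotProduct (continuous_id.matrix_mulVec continuous_const)
    fun_prop
  exact (hcont.tendsto C).comp hXC

end Probability


/-! ### From extended-valued objectives to constrained real-valued problems. -/

section Conversion

variable {p : ℕ}

/-- The value `⊤` outside `s` acts as the constraint; one point with a finite value rules it out at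
a minimizer. -/
lemma IsArgmin.of_ereal {α : Type*} {f : α → ℝ} {g : α → EReal} {s : Set α} {u : α}
    (hs : s.Nonempty) (hfg : ∀ x ∈ s, g x = f x) (htop : ∀ x ∉ s, g x = ⊤)
    (h : IsArgmin g Set.univ u) : IsArgmin f s u := by
  obtain ⟨v, hv⟩ := hs
  have hu : u ∈ s := by
    by_contra hu
    have := h.2 v trivial
    rw [htop u hu, hfg v hv] at this
    exact absurd this (not_le.2 (EReal.coe_lt_top _))
  refine ⟨hu, fun y hy => ?_⟩
  have := h.2 y trivial
  rw [hfg u hu, hfg y hy] at this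
  exact_mod_cast this

lemma IsUniqueArgmin.to_ereal {α : Type*} {f : α → ℝ} {g : α → EReal} {s : Set α} {u : α}
    (hfg : ∀ x ∈ s, g x = f x) (htop : ∀ x ∉ s, g x = ⊤)
    (h : IsUniqueArgmin f s u) : IsUniqueArgmin g Set.univ u := by
  refine ⟨⟨trivial, fun y _ => ?_⟩, fun y hy => h.2 y (hy.of_ereal ⟨u, h.1.1⟩ hfg htop)⟩
  by_cases hy : y ∈ s
  · rw [hfg u h.1.1, hfg y hy]
    exact_mod_cast h.1.2 y hy
  · rw [htop y hy]
    exact le_top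

lemma sum_mul_ofReal_abs_of_mem_feasible {S : Finset (Fin p)} {c : Fin p → ℝ≥0∞}
    {u : EuclideanSpace ℝ (Fin p)} (hu : u ∈ feasible S c) :
    ∑ j ∈ Sᶜ, c j * ENNReal.ofReal |u j| =
      ENNReal.ofReal (∑ j ∈ Sᶜ, (c j).toReal * |u j|) := by
  rw [ENNReal.ofReal_sum_of_nonneg fun _ _ => by positivity]
  refine Finset.sum_congr rfl fun j hj => ?_
  by_cases hc : c j = ∞
  · simp [hu j (Finset.mem_compl.1 hj) hc]
  · rw [ENNReal.ofReal_mul ENNReal.toReal_nonneg, ENNReal.ofReal_toReal hc]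

lemma sum_mul_ofReal_abs_of_notMem_feasible {S : Finset (Fin p)} {c : Fin p → ℝ≥0∞}
    {u : EuclideanSpace ℝ (Fin p)} (hu : u ∉ feasible S c) :
    ∑ j ∈ Sᶜ, c j * ENNReal.ofReal |u j| = ∞ := by
  obtain ⟨j, hj, hc, huj⟩ : ∃ j, j ∉ S ∧ c j = ∞ ∧ u j ≠ 0 := by
    by_contra! h
    exact hu h
  rw [ENNReal.sum_eq_top]
  exact ⟨j, Finset.mem_compl.2 hj, by rw [hc, ENNReal.top_mul (by simpa using huj)]⟩

lemma limitSmall_isUniqueArgmin {C : Matrix (Fin p) (Fin p) ℝ}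
    {βs w z u : EuclideanSpace ℝ (Fin p)} {lam₁ γ : ℝ} {α : Fin p → ℝ} (hα : ∀ j, α j = 0)
    (h : IsUniqueArgmin (penalized (activeSet βs) C w (fun j s => α j * s)
        fun j => ENNReal.ofReal lam₁ * weight γ (z j))
      (feasible (activeSet βs) fun j => ENNReal.ofReal lam₁ * weight γ (z j)) u) :
    IsUniqueArgmin (limitSmall C βs lam₁ γ w z) Set.univ u := by
  refine h.to_ereal (fun x hx => ?_) fun x hx => ?_
  · have h0 : 0 ≤ ∑ j ∈ (activeSet βs)ᶜ,
        (ENNReal.ofReal lam₁ * weight γ (z j)).toReal * |x j| := by positivity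
    rw [limitSmall, sum_mul_ofReal_abs_of_mem_feasible hx, EReal.coe_ennreal_ofReal, max_eq_left h0]
    simp [penalized, hα]
  · rw [limitSmall, sum_mul_ofReal_abs_of_notMem_feasible hx]
    simp

lemma feasible_top (βs : EuclideanSpace ℝ (Fin p)) :
    feasible (activeSet βs) (fun _ => ∞) = activeSubspace βs := by
  simp [feasible, activeSubspace]

/-- Since `(∞ : ℝ≥0∞).toReal = 0`, infinite weights leave no trace in the real objective; their
effect is carried by `feasible`. -/
lemma penalized_top (C : Matrix (Fin p) (Fin p) ℝ) (βs w : EuclideanSpace ℝ (Fin p)) (γ κ : ℝ) :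
    penalized (activeSet βs) C w (fun j s => κ * (Real.sign (βs j) / |βs j| ^ γ) * s) (fun _ => ∞) =
      fun u => quad C w u + κ * activeDrift βs γ u := by
  funext u
  simp [penalized, activeDrift, Finset.mul_sum, mul_assoc]

lemma rss_add_smul {n : ℕ} (X : Matrix (Fin n) (Fin p) ℝ) (βs u : EuclideanSpace ℝ (Fin p))
    (e : Fin n → ℝ) (t : ℝ) :
    rss X (X *ᵥ βs.ofLp + e) (βs + t • u) =
      ∑ i, e i ^ 2 - 2 * t * (u.ofLp ⬝ᵥ Xᵀ *ᵥ e) + t ^ 2 * (u.ofLp ⬝ᵥ (Xᵀ * X) *ᵥ u.ofLp) := by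
  have h1 : u.ofLp ⬝ᵥ Xᵀ *ᵥ e = ∑ i, e i * (X *ᵥ u.ofLp) i := by
    rw [Matrix.mulVec_transpose, dotProduct_comm, ← Matrix.dotProduct_mulVec]
    rfl
  have h2 : u.ofLp ⬝ᵥ (Xᵀ * X) *ᵥ u.ofLp = ∑ i, (X *ᵥ u.ofLp) i ^ 2 := by
    rw [← Matrix.mulVec_mulVec, Matrix.mulVec_transpose, dotProduct_comm,
      ← Matrix.dotProduct_mulVec]
    simp [dotProduct, sq]
  rw [h1, h2, Finset.mul_sum, Finset.mul_sum, ← Finset.sum_sub_distrib, ← Finset.sum_add_distrib]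
  refine Finset.sum_congr rfl fun i _ => ?_
  simp only [WithLp.ofLp_add, WithLp.ofLp_smul, Matrix.mulVec_add, Matrix.mulVec_smul,
    Pi.add_apply, Pi.smul_apply, smul_eq_mul]
  ring

lemma weight_ne_top {γ b : ℝ} (hγ : 0 < γ) (hb : b ≠ 0) : weight γ b ≠ ∞ := by
  simp [weight, hb, hγ, hγ.not_gt]

/-- The increment of the absolute value at `b` in direction `s`, with step `t`. -/
noncomputable def absIncrement (b t s : ℝ) : ℝ := (|b + t * s| - |b|) / t

/-- Rescaling of the Adaptive Lasso objective around the true parameter. -/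
theorem objective_eq {n : ℕ} (hn : 0 < n) {X : Matrix (Fin n) (Fin p) ℝ}
    {βs βt u : EuclideanSpace ℝ (Fin p)} {e : Fin n → ℝ} {lam γ t κ : ℝ} (hlam : 0 ≤ lam)
    (ht : 0 < t) (hκ : κ = lam / (n * t))
    (hβt : ∀ j ∈ activeSet βs, weight γ (βt j) ≠ ∞) :
    (objective X (X *ᵥ βs.ofLp + e) lam γ βt (βs + t • u) : EReal) =
      ((1 / n * ∑ i, e i ^ 2 + t ^ 2 * (quad ((1 / (n : ℝ)) • (Xᵀ * X))
        (WithLp.toLp 2 ((n * t)⁻¹ • Xᵀ *ᵥ e)) u)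
        + lam / n * ∑ j ∈ activeSet βs, (weight γ (βt j)).toReal * |βs j + t * u j| : ℝ) : EReal)
      + ((ENNReal.ofReal (t ^ 2) * ∑ j ∈ (activeSet βs)ᶜ, ENNReal.ofReal κ * weight γ (βt j) *
        ENNReal.ofReal |u j| : ℝ≥0∞) : EReal) := by
  have hn' : (0 : ℝ) < n := by exact_mod_cast hn
  have hln : 0 ≤ lam / n := by positivity
  have h1 : 1 / n * rss X (X *ᵥ βs.ofLp + e) (βs + t • u) = 1 / n * ∑ i, e i ^ 2 +
      t ^ 2 * (quad ((1 / (n : ℝ)) • (Xᵀ * X)) (WithLp.toLp 2 ((n * t)⁻¹ • Xᵀ *ᵥ e)) u) := by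
    rw [rss_add_smul]
    simp only [quad, Matrix.smul_mulVec, dotProduct_smul, smul_eq_mul]
    field_simp
    ring
  have h1' : 0 ≤ 1 / n * rss X (X *ᵥ βs.ofLp + e) (βs + t • u) := by
    have : 0 ≤ rss X (X *ᵥ βs.ofLp + e) (βs + t • u) := Finset.sum_nonneg fun _ _ => sq_nonneg _
    positivity
  have h2 : ENNReal.ofReal (lam / n) *
      ∑ j ∈ activeSet βs, weight γ (βt j) * ENNReal.ofReal |(βs + t • u) j| =
      ENNReal.ofReal (lam / n * ∑ j ∈ activeSet βs, (weight γ (βt j)).toReal * |βs j + t * u j|) := by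
    rw [ENNReal.ofReal_mul hln, ENNReal.ofReal_sum_of_nonneg fun _ _ => by positivity]
    congr 1
    refine Finset.sum_congr rfl fun j hj => ?_
    rw [ENNReal.ofReal_mul ENNReal.toReal_nonneg, ENNReal.ofReal_toReal (hβt j hj)]
    simp
  have h3 : ENNReal.ofReal (lam / n) *
      ∑ j ∈ (activeSet βs)ᶜ, weight γ (βt j) * ENNReal.ofReal |(βs + t • u) j| =
      ENNReal.ofReal (t ^ 2) * ∑ j ∈ (activeSet βs)ᶜ, ENNReal.ofReal κ * weight γ (βt j) *
        ENNReal.ofReal |u j| := by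
    rw [Finset.mul_sum, Finset.mul_sum]
    refine Finset.sum_congr rfl fun j hj => ?_
    -- At an inactive coordinate the absolute value is homogeneous: one factor `t` comes from `lam /
    -- n = t * κ`, the other from `|t * u j|`.
    have hbj : βs j = 0 := by simpa [activeSet] using hj
    have e1 : lam / n = t * κ := by
      rw [hκ]
      field_simp
    have e2 : |(βs + t • u) j| = t * |u j| := by simp [hbj, abs_mul, abs_of_pos ht]
    rw [e1, e2, ENNReal.ofReal_mul ht.le, ENNReal.ofReal_mul ht.le, sq, ENNReal.ofReal_mul ht.le]
    ring
  have h4 : 0 ≤ lam / n * ∑ j ∈ activeSet βs, (weight γ (βt j)).toReal * |βs j + t * u j| := by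
    positivity
  rw [objective, ← Finset.sum_add_sum_compl (activeSet βs), mul_add, h2, h3, ← add_assoc,
    ← ENNReal.ofReal_add h1' h4, EReal.coe_ennreal_add, EReal.coe_ennreal_ofReal,
    max_eq_left (by positivity), h1]

/-- Minimizers of the Adaptive Lasso objective are, after rescaling, minimizers of a penalized
quadratic form. -/
theorem isArgmin_penalized {n : ℕ} (hn : 0 < n) {X : Matrix (Fin n) (Fin p) ℝ}
    {βs βt u : EuclideanSpace ℝ (Fin p)} {e : Fin n → ℝ} {lam γ t κ : ℝ} (hlam : 0 ≤ lam)
    (ht : 0 < t) (hκ : κ = lam / (n * t))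
    (hβt : ∀ j ∈ activeSet βs, weight γ (βt j) ≠ ∞)
    (h : IsArgmin (objective X (X *ᵥ βs.ofLp + e) lam γ βt) Set.univ (βs + t • u)) :
    IsArgmin (penalized (activeSet βs) ((1 / (n : ℝ)) • (Xᵀ * X))
        (WithLp.toLp 2 ((n * t)⁻¹ • Xᵀ *ᵥ e))
        (fun j s => κ * (weight γ (βt j)).toReal * absIncrement (βs j) t s)
        fun j => ENNReal.ofReal κ * weight γ (βt j))
      (feasible (activeSet βs) fun j => ENNReal.ofReal κ * weight γ (βt j)) u := by
  have hn' : (0 : ℝ) < n := by exact_mod_cast hn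
  set c : Fin p → ℝ≥0∞ := fun j => ENNReal.ofReal κ * weight γ (βt j) with hc
  set f := penalized (activeSet βs) ((1 / (n : ℝ)) • (Xᵀ * X))
    (WithLp.toLp 2 ((n * t)⁻¹ • Xᵀ *ᵥ e))
    (fun j s => κ * (weight γ (βt j)).toReal * absIncrement (βs j) t s) c with hf
  -- The objective at `u = 0`. Neither this constant nor the factor `t ^ 2 > 0` affects minimizers.
  set K := 1 / n * ∑ i, e i ^ 2 +
    lam / n * ∑ j ∈ activeSet βs, (weight γ (βt j)).toReal * |βs j| with hK
  have hmin : IsArgmin (fun v => t ^ 2 * f v + K) (feasible (activeSet βs) c) u := by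
    refine IsArgmin.of_ereal
      (g := fun v => (objective X (X *ᵥ βs.ofLp + e) lam γ βt (βs + t • v) : EReal))
      ⟨0, zero_mem_feasible c⟩ (fun v hv => ?_) (fun v hv => ?_)
      ⟨trivial, fun v _ => EReal.coe_ennreal_le_coe_ennreal_iff.2 (h.2 (βs + t • v) trivial)⟩
    · have h0 : 0 ≤ t ^ 2 * ∑ j ∈ (activeSet βs)ᶜ, (c j).toReal * |v j| := by positivity
      rw [objective_eq hn hlam ht hκ hβt, sum_mul_ofReal_abs_of_mem_feasible hv,
        ← ENNReal.ofReal_mul (sq_nonneg t), EReal.coe_ennreal_ofReal, max_eq_left h0,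
        ← EReal.coe_add]
      congr 1
      have e1 : lam / n * ∑ j ∈ activeSet βs, (weight γ (βt j)).toReal * |βs j + t * v j| =
          t ^ 2 * ∑ j ∈ activeSet βs, κ * (weight γ (βt j)).toReal * absIncrement (βs j) t (v j) +
          lam / n * ∑ j ∈ activeSet βs, (weight γ (βt j)).toReal * |βs j| := by
        rw [Finset.mul_sum, Finset.mul_sum, Finset.mul_sum, ← Finset.sum_add_distrib]
        refine Finset.sum_congr rfl fun j _ => ?_
        rw [absIncrement, hκ]
        field_simp
        ring
      rw [e1]
      simp only [hf, penalized, hK]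
      ring
    · have ht2 : ENNReal.ofReal (t ^ 2) ≠ 0 := by simpa using ht.ne'
      rw [objective_eq hn hlam ht hκ hβt, sum_mul_ofReal_abs_of_notMem_feasible hv,
        ENNReal.mul_top ht2, EReal.coe_ennreal_top, EReal.coe_add_top]
  refine ⟨hmin.1, fun v hv => ?_⟩
  have := hmin.2 v hv
  simp only [add_le_add_iff_right] at this
  exact le_of_mul_le_mul_left this (by positivity)

end Conversion

/-! ### Limits of the penalty increments and of the weights. -/

section Limits

lemma abs_absIncrement_le {t : ℝ} (ht : 0 < t) (b s : ℝ) : |absIncrement b t s| ≤ |s| := by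
  rw [absIncrement, abs_div, abs_of_pos ht, div_le_iff₀ ht]
  calc |(|b + t * s| - |b|)| ≤ |b + t * s - b| := abs_abs_sub_abs_le _ _
    _ = |s| * t := by rw [add_sub_cancel_left, abs_mul, abs_of_pos ht, mul_comm]

lemma absIncrement_eq {b t s : ℝ} (hb : b ≠ 0) (ht : 0 < t) (h : |t * s| ≤ |b|) :
    absIncrement b t s = Real.sign b * s := by
  have h' := abs_le.1 h
  rw [absIncrement, div_eq_iff ht.ne']
  rcases hb.lt_or_gt with hb | hb
  · rw [abs_of_neg hb] at h' ⊢
    rw [Real.sign_of_neg hb, abs_of_nonpos (by linarith [h'.2])]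
    ring
  · rw [abs_of_pos hb] at h' ⊢
    rw [Real.sign_of_pos hb, abs_of_nonneg (by linarith [h'.1])]
    ring

/-- For small `t` and bounded `s` the step does not cross zero, so the increment eventually equals
its linear limit. -/
lemma tendsto_absIncrement {ι : Type*} {l : Filter ι} {t : ι → ℝ} (ht : Tendsto t l (𝓝 0))
    (htpos : ∀ᶠ i in l, 0 < t i) {b : ℝ} (hb : b ≠ 0) (s : ℝ) :
    Tendsto (fun q : ι × ℝ => absIncrement b (t q.1) q.2) (l ×ˢ 𝓝 s) (𝓝 (Real.sign b * s)) := by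
  have h1 : Tendsto (fun q : ι × ℝ => t q.1 * q.2) (l ×ˢ 𝓝 s) (𝓝 (0 * s)) :=
    (ht.comp tendsto_fst).mul tendsto_snd
  have h2 : Tendsto (fun q : ι × ℝ => Real.sign b * q.2) (l ×ˢ 𝓝 s) (𝓝 (Real.sign b * s)) :=
    tendsto_snd.const_mul _
  rw [zero_mul] at h1
  refine h2.congr' ?_
  have h3 : ∀ᶠ q : ι × ℝ in l ×ˢ 𝓝 s, |t q.1 * q.2| < |b| :=
    h1.abs.eventually_lt_const (by simpa using hb)
  filter_upwards [h3, tendsto_fst.eventually htpos] with q hq hqt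
  exact (absIncrement_eq hb hqt hq.le).symm

/-- Continuity includes the point `0`, which is what values in `ℝ≥0∞` provide. -/
lemma continuous_weight (γ : ℝ) : Continuous (weight γ) := by
  unfold weight
  exact continuous_inv.comp (ENNReal.continuous_rpow_const.comp
    (ENNReal.continuous_ofReal.comp continuous_abs))

lemma weight_ne_zero {γ : ℝ} (hγ : 0 < γ) (b : ℝ) : weight γ b ≠ 0 := by
  rw [weight, ENNReal.inv_ne_zero]
  exact ENNReal.rpow_ne_top_of_nonneg hγ.le ENNReal.ofReal_ne_top

lemma weight_zero {γ : ℝ} (hγ : 0 < γ) : weight γ 0 = ∞ := by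
  simp [weight, hγ]

lemma toReal_weight {γ b : ℝ} : (weight γ b).toReal = (|b| ^ γ)⁻¹ := by
  rw [weight, ENNReal.toReal_inv, ← ENNReal.toReal_rpow, ENNReal.toReal_ofReal (abs_nonneg b)]

/-- With `r = √m` this extracts the factor `m ^ (γ / 2)` from the weight of an inactive coordinate.
-/
lemma weight_inv_mul {γ r : ℝ} (hγ : 0 < γ) (hr : 0 < r) (b : ℝ) :
    weight γ (r⁻¹ * b) = ENNReal.ofReal (r ^ γ) * weight γ b := by
  have hr' : ENNReal.ofReal r ≠ 0 := by simpa using hr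
  rw [weight, weight, abs_mul, abs_of_pos (inv_pos.2 hr), ENNReal.ofReal_mul (inv_pos.2 hr).le,
    ENNReal.mul_rpow_of_nonneg _ _ hγ.le, ENNReal.ofReal_inv_of_pos hr, ENNReal.inv_rpow,
    ENNReal.mul_inv (Or.inl (by simp [hr', hγ, ENNReal.rpow_eq_top_iff])) (Or.inl (by
      simp [hr', hγ, ENNReal.rpow_eq_zero_iff])), inv_inv,
    ENNReal.ofReal_rpow_of_pos hr]

lemma tendsto_natCast_atTop_of_div {m : ℕ → ℕ} (hm : ∀ᶠ n in atTop, 0 < m n) {r₀ : ℝ}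
    (hr₀ : 0 ≤ r₀) (hmr : Tendsto (fun n : ℕ => (n : ℝ) / (m n : ℝ)) atTop (𝓝 r₀)) :
    Tendsto (fun n => (m n : ℝ)) atTop atTop := by
  have h1 : Tendsto (fun n : ℕ => (n : ℝ) / (r₀ + 1)) atTop atTop :=
    tendsto_natCast_atTop_atTop.atTop_div_const (by positivity)
  refine tendsto_atTop_mono' _ ?_ h1
  filter_upwards [hm, hmr.eventually_lt_const (lt_add_one r₀)] with n hn h
  have hn' : (0 : ℝ) < m n := by exact_mod_cast hn
  rw [div_lt_iff₀ hn'] at h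
  rw [div_le_iff₀ (by positivity)]
  linarith

end Limits


/-! ### The limit theorem for a general scaling. -/

section Asymptotics

variable {p : ℕ}

/-- Stability of minimizers, uniformly over all minimizers of the approximating problems. -/
theorem eventually_argmin_mem {ι : Type*} {l : Filter ι} {S : Finset (Fin p)}
    {C : Matrix (Fin p) (Fin p) ℝ} {A : ι → Matrix (Fin p) (Fin p) ℝ}
    {w : ι → EuclideanSpace ℝ (Fin p)} {ρ : ι → Fin p → ℝ → ℝ} {c : ι → Fin p → ℝ≥0∞}
    {w₀ u₀ : EuclideanSpace ℝ (Fin p)} {α : Fin p → ℝ}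
    {c₀ : Fin p → ℝ≥0∞} (hC : C.PosDef) (hA : Tendsto A l (𝓝 C)) (hw : Tendsto w l (𝓝 w₀))
    (hc : ∀ j ∉ S, Tendsto (fun i => c i j) l (𝓝 (c₀ j))) {a : ℝ}
    (hρa : ∀ᶠ i in l, ∀ j ∈ S, ∀ s, |ρ i j s| ≤ a * |s|)
    (hρ : ∀ j ∈ S, ∀ s, Tendsto (fun q : ι × ℝ => ρ q.1 j q.2) (l ×ˢ 𝓝 s) (𝓝 (α j * s)))
    (hu₀ : IsUniqueArgmin (penalized S C w₀ (fun j s => α j * s) c₀) (feasible S c₀) u₀)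
    {V : Set (EuclideanSpace ℝ (Fin p))} (hV : V ∈ 𝓝 u₀) :
    ∀ᶠ i in l, ∀ y, IsArgmin (penalized S (A i) (w i) (ρ i) (c i)) (feasible S (c i)) y →
      y ∈ V := by
  -- Choose an offending minimizer at each bad index. Along `l ⊓ 𝓟 B` these would converge to `u₀`
  -- and so enter `V`, hence bad indices are eventually absent.
  set B : Set ι := {i | ∃ y, IsArgmin (penalized S (A i) (w i) (ρ i) (c i)) (feasible S (c i)) y ∧
    y ∉ V} with hB
  have hex : ∀ i, ∃ y, i ∈ B →
      IsArgmin (penalized S (A i) (w i) (ρ i) (c i)) (feasible S (c i)) y ∧ y ∉ V := fun i => by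
    by_cases hi : i ∈ B
    · obtain ⟨y, hy⟩ := hi
      exact ⟨y, fun _ => hy⟩
    · exact ⟨0, fun h => absurd h hi⟩
  choose u hu using hex
  have hle : l ⊓ 𝓟 B ≤ l := inf_le_left
  have hBmem : ∀ᶠ i in l ⊓ 𝓟 B, i ∈ B := mem_inf_of_right (mem_principal_self B)
  have hlim : Tendsto u (l ⊓ 𝓟 B) (𝓝 u₀) :=
    tendsto_argmin hC (hA.mono_left hle) (hw.mono_left hle) (fun j hj => (hc j hj).mono_left hle)
      (hρa.filter_mono hle) (fun j hj s => (hρ j hj s).mono_left (Filter.prod_mono_left _ hle))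
      (hBmem.mono fun i hi => (hu i hi).1) hu₀
  have hfalse : ∀ᶠ i in l, i ∈ B → False := by
    rw [← Filter.eventually_inf_principal]
    filter_upwards [hlim hV, hBmem] with i hi hiB
    exact (hu i hiB).2 hi
  filter_upwards [hfalse] with i hi y hy
  by_contra hyV
  exact hi ⟨y, hy, hyV⟩

/-- The minimizer of the limit problem, as a function of the linear term and the weights. -/
noncomputable def limitArgmin {C : Matrix (Fin p) (Fin p) ℝ} (hC : C.PosDef) (S : Finset (Fin p))
    (α : Fin p → ℝ) (w : EuclideanSpace ℝ (Fin p)) (c : Fin p → ℝ≥0∞) :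
    EuclideanSpace ℝ (Fin p) :=
  (exists_isUniqueArgmin (S := S) hC w α c).choose

lemma limitArgmin_spec {C : Matrix (Fin p) (Fin p) ℝ} (hC : C.PosDef) (S : Finset (Fin p))
    (α : Fin p → ℝ) (w : EuclideanSpace ℝ (Fin p)) (c : Fin p → ℝ≥0∞) :
    IsUniqueArgmin (penalized S C w (fun j s => α j * s) c) (feasible S c)
      (limitArgmin hC S α w c) :=
  (exists_isUniqueArgmin (S := S) hC w α c).choose_spec

/-- Stability applied to the limit problem itself, along a neighbourhood filter of its data; it
yields measurability of the limit variable. -/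
lemma continuous_limitArgmin {C : Matrix (Fin p) (Fin p) ℝ} (hC : C.PosDef) (S : Finset (Fin p))
    (α : Fin p → ℝ) :
    Continuous fun q : EuclideanSpace ℝ (Fin p) × (Fin p → ℝ≥0∞) =>
      limitArgmin hC S α q.1 q.2 := by
  refine continuous_iff_continuousAt.2 fun q₀ => ?_
  refine tendsto_argmin (S := S) (A := fun _ => C)
    (w := fun q : EuclideanSpace ℝ (Fin p) × (Fin p → ℝ≥0∞) => q.1)
    (ρ := fun _ j s => α j * s) (c := fun q => q.2) (α := α) (c₀ := q₀.2) (a := ∑ j, |α j|) hC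
    tendsto_const_nhds continuous_fst.continuousAt
    (fun j _ => ((continuous_apply j).comp continuous_snd).continuousAt)
    (Eventually.of_forall fun _ j _ s => ?_) (fun j _ s => tendsto_snd.const_mul _)
    (Eventually.of_forall fun q => (limitArgmin_spec hC S α q.1 q.2).1)
    (limitArgmin_spec hC S α q₀.1 q₀.2)
  rw [abs_mul]
  gcongr
  exact Finset.single_le_sum (f := fun j => |α j|) (fun _ _ => abs_nonneg _) (Finset.mem_univ j)

lemma aemeasurable_limitArgmin {C : Matrix (Fin p) (Fin p) ℝ} (hC : C.PosDef)
    (S : Finset (Fin p)) (α : Fin p → ℝ) {Ω' : Type*} [MeasurableSpace Ω'] {Q : Measure Ω'}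
    {W z : Ω' → EuclideanSpace ℝ (Fin p)} (hW : AEMeasurable W Q) (hz : AEMeasurable z Q) (r : ℝ)
    {c₀ : ℝ → ℝ≥0∞} (hc₀ : Continuous c₀) :
    AEMeasurable (fun ω => limitArgmin hC S α (r • W ω) fun j => c₀ (z ω j)) Q := by
  have h1 : Measurable fun x : EuclideanSpace ℝ (Fin p) => fun j => c₀ (x j) :=
    measurable_pi_lambda _ fun j => hc₀.measurable.comp (by fun_prop)
  have h2 : AEMeasurable (fun ω => (r • W ω, fun j => c₀ (z ω j))) Q :=
    (hW.const_smul r).prodMk (h1.comp_aemeasurable hz)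
  have h3 := (continuous_limitArgmin hC S α).measurable.comp_aemeasurable h2
  simpa only [Function.comp_def] using h3

/-- Convergence of the data of the rescaled Adaptive Lasso problems implies that their minimizers
are close to the minimizer of the limit problem. -/
theorem eventually_argmin_penalized_mem {βs : EuclideanSpace ℝ (Fin p)} {γ : ℝ} (hγ : 0 < γ)
    {A : ℕ → Matrix (Fin p) (Fin p) ℝ} {C : Matrix (Fin p) (Fin p) ℝ} (hC : C.PosDef)
    (hA : Tendsto A atTop (𝓝 C)) {μ t κ r : ℕ → ℝ} {κ₀ r₁ : ℝ}
    (hμ : Tendsto μ atTop atTop) (ht : Tendsto t atTop (𝓝 0)) (htpos : ∀ᶠ n in atTop, 0 < t n)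
    (hκ : Tendsto κ atTop (𝓝 κ₀)) (hr : Tendsto r atTop (𝓝 r₁)) {c₀ : Fin p → ℝ≥0∞}
    {w z u₀ : EuclideanSpace ℝ (Fin p)}
    (hc : ∀ j ∉ activeSet βs, Tendsto
      (fun q : ℕ × ℝ => ENNReal.ofReal (κ q.1) * weight γ ((μ q.1)⁻¹ * q.2))
      (atTop ×ˢ 𝓝 (z j)) (𝓝 (c₀ j)))
    (hu₀ : IsUniqueArgmin (penalized (activeSet βs) C (r₁ • w)
        (fun j s => κ₀ * (Real.sign (βs j) / |βs j| ^ γ) * s) c₀) (feasible (activeSet βs) c₀) u₀)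
    {V : Set (EuclideanSpace ℝ (Fin p))} (hV : V ∈ 𝓝 u₀) :
    ∀ᶠ q : ℕ × EuclideanSpace ℝ (Fin p) × EuclideanSpace ℝ (Fin p) in atTop ×ˢ 𝓝 (w, z),
      (∀ j ∈ activeSet βs, weight γ ((βs + (μ q.1)⁻¹ • q.2.2) j) ≠ ∞) ∧
      ∀ y, IsArgmin (penalized (activeSet βs) (A q.1) (r q.1 • q.2.1)
          (fun j s => κ q.1 * (weight γ ((βs + (μ q.1)⁻¹ • q.2.2) j)).toReal *
            absIncrement (βs j) (t q.1) s)
          fun j => ENNReal.ofReal (κ q.1) * weight γ ((βs + (μ q.1)⁻¹ • q.2.2) j))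
        (feasible (activeSet βs)
          fun j => ENNReal.ofReal (κ q.1) * weight γ ((βs + (μ q.1)⁻¹ • q.2.2) j)) y → y ∈ V := by
  set l : Filter (ℕ × EuclideanSpace ℝ (Fin p) × EuclideanSpace ℝ (Fin p)) :=
    atTop ×ˢ 𝓝 (w, z) with hl
  have hfst : Tendsto (fun q : ℕ × EuclideanSpace ℝ (Fin p) × EuclideanSpace ℝ (Fin p) => q.1) l
      atTop := tendsto_fst
  have hw : Tendsto (fun q : ℕ × EuclideanSpace ℝ (Fin p) × EuclideanSpace ℝ (Fin p) => q.2.1) l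
      (𝓝 w) := (continuous_fst.tendsto (w, z)).comp tendsto_snd
  have hz : Tendsto (fun q : ℕ × EuclideanSpace ℝ (Fin p) × EuclideanSpace ℝ (Fin p) => q.2.2) l
      (𝓝 z) := (continuous_snd.tendsto (w, z)).comp tendsto_snd
  have hβt : ∀ j, Tendsto (fun q : ℕ × EuclideanSpace ℝ (Fin p) × EuclideanSpace ℝ (Fin p) =>
      (βs + (μ q.1)⁻¹ • q.2.2) j) l (𝓝 (βs j)) := fun j => by
    have h := ((hμ.inv_tendsto_atTop.comp hfst).mul (tendsto_apply_of_tendsto hz j)).const_add (βs j)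
    simpa using h
  have hwt : ∀ j, Tendsto (fun q : ℕ × EuclideanSpace ℝ (Fin p) × EuclideanSpace ℝ (Fin p) =>
      weight γ ((βs + (μ q.1)⁻¹ • q.2.2) j)) l (𝓝 (weight γ (βs j))) := fun j => by
    have h := ((continuous_weight γ).tendsto (βs j)).comp (hβt j)
    exact h
  have hβs : ∀ j ∈ activeSet βs, βs j ≠ 0 := fun j hj => by simpa [activeSet] using hj
  have hfin : ∀ᶠ q in l, ∀ j ∈ activeSet βs, weight γ ((βs + (μ q.1)⁻¹ • q.2.2) j) ≠ ∞ := by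
    rw [Filter.eventually_all_finset]
    exact fun j hj => (hwt j).eventually_ne (weight_ne_top hγ (hβs j hj))
  have hcoef : ∀ j ∈ activeSet βs, Tendsto
      (fun q : ℕ × EuclideanSpace ℝ (Fin p) × EuclideanSpace ℝ (Fin p) =>
        κ q.1 * (weight γ ((βs + (μ q.1)⁻¹ • q.2.2) j)).toReal) l
      (𝓝 (κ₀ * (|βs j| ^ γ)⁻¹)) := fun j hj => by
    rw [← toReal_weight]
    have h := (ENNReal.tendsto_toReal (weight_ne_top hγ (hβs j hj))).comp (hwt j)
    exact (hκ.comp hfst).mul h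
  refine hfin.and (eventually_argmin_mem hC (hA.comp hfst) ((hr.comp hfst).smul hw)
    (fun j hj => ?_) (a := ∑ j ∈ activeSet βs, (|κ₀ * (|βs j| ^ γ)⁻¹| + 1)) ?_
    (fun j hj s => ?_) hu₀ hV)
  · have hbj : βs j = 0 := by simpa [activeSet] using hj
    have h := (hc j hj).comp (hfst.prodMk (tendsto_apply_of_tendsto hz j))
    simpa [hbj, Function.comp_def] using h
  · have h1 : ∀ᶠ q in l, ∀ j ∈ activeSet βs,
        |κ q.1 * (weight γ ((βs + (μ q.1)⁻¹ • q.2.2) j)).toReal| < |κ₀ * (|βs j| ^ γ)⁻¹| + 1 := by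
      rw [Filter.eventually_all_finset]
      exact fun j hj => (hcoef j hj).abs.eventually_lt_const (lt_add_one _)
    filter_upwards [h1, hfst.eventually htpos] with q hq hqt j hj s
    rw [abs_mul]
    refine mul_le_mul ((hq j hj).le.trans ?_) (abs_absIncrement_le hqt _ _) (abs_nonneg _)
      (by positivity)
    exact Finset.single_le_sum (f := fun j => |κ₀ * (|βs j| ^ γ)⁻¹| + 1)
      (fun _ _ => by positivity) hj
  · have h1 := tendsto_absIncrement (ht.comp hfst) (hfst.eventually htpos) (hβs j hj) s
    have h2 := ((hcoef j hj).comp (tendsto_fst (g := 𝓝 s))).mul h1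
    rw [show κ₀ * (Real.sign (βs j) / |βs j| ^ γ) * s =
      κ₀ * (|βs j| ^ γ)⁻¹ * (Real.sign (βs j) * s) by ring]
    exact h2

/-- Asymptotic distribution of the Adaptive Lasso for a general scaling `(t n)⁻¹`: the limits of
`lam n / (n * t n)`, of `1 / (√n * t n)` and of the penalty weights determine the limit problem. -/
theorem tendstoInDistribution_of_scaling
    (βs : EuclideanSpace ℝ (Fin p)) (σ : ℝ≥0) (γ : ℝ) (hγ : 0 < γ)
    (X : (n : ℕ) → Matrix (Fin n) (Fin p) ℝ) (C : Matrix (Fin p) (Fin p) ℝ) (hC : C.PosDef)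
    (hXC : Tendsto (fun n : ℕ => (1 / (n : ℝ)) • ((X n)ᵀ * X n)) atTop (𝓝 C))
    (m : ℕ → ℕ) (hm : ∀ᶠ n in atTop, 0 < m n)
    (hm_top : Tendsto (fun n => (m n : ℝ)) atTop atTop)
    (lam : ℕ → ℝ) (hlam : ∀ n, 0 ≤ lam n)
    {Ω : ℕ → Type*} [∀ n, MeasurableSpace (Ω n)] (P : (n : ℕ) → Measure (Ω n))
    [∀ n, IsProbabilityMeasure (P n)]
    (ε : (n : ℕ) → Ω n → Fin n → ℝ)
    (hε_indep : ∀ n, iIndepFun (fun i ω => ε n ω i) (P n))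
    (hε_law : ∀ n i, HasLaw (fun ω => ε n ω i) (gaussianReal 0 (σ ^ 2)) (P n))
    (βt : (n : ℕ) → Ω n → EuclideanSpace ℝ (Fin p))
    (hβtε : ∀ n, IndepFun (βt n) (ε n) (P n))
    {Ω' : Type*} [MeasurableSpace Ω'] (Q : Measure Ω') [IsProbabilityMeasure Q]
    (W z : Ω' → EuclideanSpace ℝ (Fin p))
    (hW : HasLaw W (multivariateGaussian 0 (((σ : ℝ) ^ 2) • C)) Q)
    (hWz : IndepFun W z Q)
    (hz : TendstoInDistribution
      (fun n ω => √(m n : ℝ) • (βt n ω - βs)) atTop z P Q)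
    (βh : (n : ℕ) → Ω n → EuclideanSpace ℝ (Fin p))
    (hβh_meas : ∀ n, AEMeasurable (βh n) (P n))
    (hβh : ∀ n, ∀ᵐ ω ∂(P n), IsArgmin
      (objective (X n) (X n *ᵥ βs.ofLp + ε n ω) (lam n) γ (βt n ω)) Set.univ (βh n ω))
    (t : ℕ → ℝ) (htpos : ∀ᶠ n in atTop, 0 < t n) (ht : Tendsto t atTop (𝓝 0)) {κ₀ r₁ : ℝ}
    (hκ : Tendsto (fun n : ℕ => lam n / (n * t n)) atTop (𝓝 κ₀))
    (hr : Tendsto (fun n : ℕ => (√(n : ℝ) * t n)⁻¹) atTop (𝓝 r₁))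
    (c₀ : ℝ → ℝ≥0∞) (hc₀ : Continuous c₀)
    (hc : ∀ j ∉ activeSet βs, ∀ᵐ ω ∂Q, Tendsto
      (fun q : ℕ × ℝ => ENNReal.ofReal (lam q.1 / (q.1 * t q.1)) *
        weight γ ((√(m q.1 : ℝ))⁻¹ * q.2)) (atTop ×ˢ 𝓝 (z ω j)) (𝓝 (c₀ (z ω j)))) :
    TendstoInDistribution (fun n ω => (t n)⁻¹ • (βh n ω - βs)) atTop
      (fun ω => limitArgmin hC (activeSet βs)
        (fun j => κ₀ * (Real.sign (βs j) / |βs j| ^ γ)) (r₁ • W ω) fun j => c₀ (z ω j)) P Q := by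
  have hscore := tendstoInDistribution_score hC hXC hε_indep hε_law hW
  have hjoint := tendstoInDistribution_prodMk_of_indepFun hscore hz (fun n => by
    have h1 : Measurable fun b : EuclideanSpace ℝ (Fin p) => √(m n : ℝ) • (b - βs) := by fun_prop
    have h2 : Continuous fun x : Fin n → ℝ => WithLp.toLp 2 (((√(n : ℝ))⁻¹ • (X n)ᵀ) *ᵥ x) :=
      (PiLp.continuous_toLp 2 _).comp (Continuous.matrix_mulVec continuous_const continuous_id)
    exact (hβtε n).symm.comp h2.measurable h1) hWz
  have hμ : Tendsto (fun n => √(m n : ℝ)) atTop atTop := Real.tendsto_sqrt_atTop.comp hm_top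
  have hc' : ∀ᵐ ω ∂Q, ∀ j ∉ activeSet βs, Tendsto
      (fun q : ℕ × ℝ => ENNReal.ofReal (lam q.1 / (q.1 * t q.1)) *
        weight γ ((√(m q.1 : ℝ))⁻¹ * q.2)) (atTop ×ˢ 𝓝 (z ω j)) (𝓝 (c₀ (z ω j))) := by
    rw [ae_all_iff]
    exact fun j => by
      by_cases hj : j ∈ activeSet βs
      · simp [hj]
      · simpa [hj] using hc j hj
  refine tendstoInDistribution_of_relation hjoint (fun n => ?_) ?_
    -- The premise lets the relation hold almost surely for each large `n`, even if an active
    -- coordinate of the initial estimator is zero. It costs nothing, since it is automatic for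
    -- large `n` and data near the limit.
    (fun n x y => (∀ j ∈ activeSet βs, weight γ ((βs + (√(m n : ℝ))⁻¹ • x.2) j) ≠ ∞) →
      IsArgmin (penalized (activeSet βs) ((1 / (n : ℝ)) • ((X n)ᵀ * X n))
          ((√(n : ℝ) * t n)⁻¹ • x.1)
          (fun j s => lam n / (n * t n) * (weight γ ((βs + (√(m n : ℝ))⁻¹ • x.2) j)).toReal *
            absIncrement (βs j) (t n) s)
          fun j => ENNReal.ofReal (lam n / (n * t n)) * weight γ ((βs + (√(m n : ℝ))⁻¹ • x.2) j))
        (feasible (activeSet βs)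
          fun j => ENNReal.ofReal (lam n / (n * t n)) *
            weight γ ((βs + (√(m n : ℝ))⁻¹ • x.2) j)) y) ?_ ?_
  · have h : Measurable fun b : EuclideanSpace ℝ (Fin p) => (t n)⁻¹ • (b - βs) := by fun_prop
    exact h.comp_aemeasurable (hβh_meas n)
  · exact aemeasurable_limitArgmin hC _ _ hW.aemeasurable hz.aemeasurable_limit r₁ hc₀
  · filter_upwards [htpos, hm, eventually_gt_atTop 0] with n htn hmn hn
    filter_upwards [hβh n] with ω hω hfin
    have hμn : √(m n : ℝ) ≠ 0 := (Real.sqrt_pos.2 (by exact_mod_cast hmn)).ne'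
    have hsn : √(n : ℝ) * √(n : ℝ) = n := Real.mul_self_sqrt (Nat.cast_nonneg n)
    have e1 : βs + (√(m n : ℝ))⁻¹ • √(m n : ℝ) • (βt n ω - βs) = βt n ω := by
      rw [inv_smul_smul₀ hμn, add_sub_cancel]
    have e2 : βs + t n • (t n)⁻¹ • (βh n ω - βs) = βh n ω := by
      rw [smul_inv_smul₀ htn.ne', add_sub_cancel]
    have e3 : (√(n : ℝ) * t n)⁻¹ • WithLp.toLp 2 (((√(n : ℝ))⁻¹ • (X n)ᵀ) *ᵥ ε n ω) =
        WithLp.toLp 2 ((n * t n)⁻¹ • (X n)ᵀ *ᵥ ε n ω) := by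
      rw [Matrix.smul_mulVec, WithLp.toLp_smul, WithLp.toLp_smul, smul_smul, ← mul_inv,
        mul_right_comm, hsn]
    simp only [e1, e3] at hfin ⊢
    rw [← e2] at hω
    exact isArgmin_penalized hn (hlam n) htn rfl hfin hω
  · filter_upwards [hc'] with ω hω V hV
    filter_upwards [eventually_argmin_penalized_mem hγ hC hXC hμ ht htpos hκ hr
      (c₀ := fun j => c₀ (z ω j)) hω (limitArgmin_spec hC (activeSet βs)
        (fun j => κ₀ * (Real.sign (βs j) / |βs j| ^ γ)) (r₁ • W ω) fun j => c₀ (z ω j)) hV]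
      with q hq y hy
    exact hq.2 y (hy hq.1)

end Asymptotics


/-! ### Limits of the scaling factors. -/

section ScalingLimits

/-- By homogeneity the weight is `√(m ^ γ / n) * lam n` times `weight γ s`. The hypothesis `hs`
excludes the limit `0 * ∞`, where multiplication is discontinuous; this is why `lam₁ = 0` requires
`z j ≠ 0` almost surely. -/
lemma tendsto_weight_scaled {γ : ℝ} (hγ : 0 < γ) {lam : ℕ → ℝ} {m : ℕ → ℕ} {L : ℝ≥0∞}
    (hm : ∀ᶠ n in atTop, 0 < m n) (hlam : ∀ n, 0 ≤ lam n)
    (hL : Tendsto (fun n : ℕ => ENNReal.ofReal (√((m n : ℝ) ^ γ / (n : ℝ)) * lam n)) atTop (𝓝 L))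
    {s : ℝ} (hs : L ≠ 0 ∨ s ≠ 0) :
    Tendsto (fun q : ℕ × ℝ => ENNReal.ofReal (lam q.1 / √(q.1 : ℝ)) *
      weight γ ((√(m q.1 : ℝ))⁻¹ * q.2)) (atTop ×ˢ 𝓝 s) (𝓝 (L * weight γ s)) := by
  have h1 : Tendsto (fun q : ℕ × ℝ => weight γ q.2) (atTop ×ˢ 𝓝 s) (𝓝 (weight γ s)) :=
    ((continuous_weight γ).tendsto s).comp tendsto_snd
  have h2 : Tendsto (fun q : ℕ × ℝ => ENNReal.ofReal (√((m q.1 : ℝ) ^ γ / (q.1 : ℝ)) * lam q.1) *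
      weight γ q.2) (atTop ×ˢ 𝓝 s) (𝓝 (L * weight γ s)) :=
    ENNReal.Tendsto.mul (hL.comp tendsto_fst) (hs.imp_right fun h => weight_ne_top hγ h) h1
      (Or.inl (weight_ne_zero hγ s))
  refine h2.congr' ?_
  filter_upwards [tendsto_fst.eventually hm] with q hq
  have hmq : (0 : ℝ) < m q.1 := by exact_mod_cast hq
  have hln : 0 ≤ lam q.1 / √(q.1 : ℝ) := div_nonneg (hlam _) (Real.sqrt_nonneg _)
  rw [weight_inv_mul hγ (Real.sqrt_pos.2 hmq), ← mul_assoc, ← ENNReal.ofReal_mul hln,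
    Real.sqrt_div (by positivity), Real.sqrt_eq_rpow, Real.sqrt_eq_rpow (m q.1 : ℝ),
    ← Real.rpow_mul hmq.le, ← Real.rpow_mul hmq.le, mul_comm γ]
  congr 2
  ring

/-- The quotient is a convergent sequence divided by `√(m ^ γ) → ∞`; hence the active coordinates
carry no bias in regime (i). -/
lemma tendsto_div_sqrt_zero {γ : ℝ} (hγ : 0 < γ) {lam : ℕ → ℝ} {m : ℕ → ℕ} {lam₁ : ℝ}
    (hm_top : Tendsto (fun n => (m n : ℝ)) atTop atTop)
    (hL : Tendsto (fun n : ℕ => √((m n : ℝ) ^ γ / (n : ℝ)) * lam n) atTop (𝓝 lam₁)) :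
    Tendsto (fun n : ℕ => lam n / √(n : ℝ)) atTop (𝓝 0) := by
  have h1 : Tendsto (fun n => (√((m n : ℝ) ^ γ))⁻¹) atTop (𝓝 0) :=
    (Real.tendsto_sqrt_atTop.comp ((tendsto_rpow_atTop hγ).comp hm_top)).inv_tendsto_atTop
  have h2 := hL.mul h1
  rw [mul_zero] at h2
  refine h2.congr' ?_
  filter_upwards [hm_top.eventually_gt_atTop 0] with n hn
  have : √((m n : ℝ) ^ γ) ≠ 0 := (Real.sqrt_pos.2 (by positivity)).ne'
  rw [Real.sqrt_div (by positivity)]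
  field_simp

lemma natCast_mul_inv_sqrt (n : ℕ) : (n : ℝ) * (√(n : ℝ))⁻¹ = √(n : ℝ) := by
  rw [← div_eq_mul_inv, Real.div_sqrt]

lemma tendsto_inv_sqrt_natCast : Tendsto (fun n : ℕ => (√(n : ℝ))⁻¹) atTop (𝓝 0) :=
  (Real.tendsto_sqrt_atTop.comp tendsto_natCast_atTop_atTop).inv_tendsto_atTop

lemma eventually_inv_sqrt_natCast_pos : ∀ᶠ n : ℕ in atTop, 0 < (√(n : ℝ))⁻¹ := by
  filter_upwards [eventually_gt_atTop 0] with n hn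
  have : (0 : ℝ) < n := by exact_mod_cast hn
  positivity

lemma tendsto_inv_sqrt_mul_inv_sqrt :
    Tendsto (fun n : ℕ => (√(n : ℝ) * (√(n : ℝ))⁻¹)⁻¹) atTop (𝓝 1) := by
  refine tendsto_const_nhds.congr' ?_
  filter_upwards [eventually_inv_sqrt_natCast_pos] with n hn
  rw [mul_inv_cancel₀ (inv_pos.1 hn).ne', inv_one]

end ScalingLimits

end AdaptiveLasso

/-! ### The three regimes. -/

theorem mainTheorem10 {p : ℕ}
    -- true parameter, noise level, exponent
    (βs : EuclideanSpace ℝ (Fin p)) (σ : ℝ≥0) (γ : ℝ) (hγ : 0 < γ)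
    -- design matrices with `n` rows
    (X : (n : ℕ) → Matrix (Fin n) (Fin p) ℝ) (C : Matrix (Fin p) (Fin p) ℝ) (hC : C.PosDef)
    (hXC : Tendsto (fun n : ℕ => (1 / (n : ℝ)) • ((X n)ᵀ * X n)) atTop (𝓝 C))
    (hXmax : Tendsto (fun n : ℕ => 1 / (n : ℝ) * ⨆ i, ∑ j, X n i j ^ 2) atTop (𝓝 0))
    -- source sample sizes
    (m : ℕ → ℕ) (hm : ∀ᶠ n in atTop, 0 < m n) (r₀ : ℝ) (hr₀ : 0 ≤ r₀)
    (hmr : Tendsto (fun n : ℕ => (n : ℝ) / (m n : ℝ)) atTop (𝓝 r₀))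
    -- regularization parameters
    (lam : ℕ → ℝ) (hlam : ∀ n, 0 ≤ lam n)
    -- the probability space of the `n`-th experiment, with i.i.d. Gaussian noise
    {Ω : ℕ → Type*} [∀ n, MeasurableSpace (Ω n)] (P : (n : ℕ) → Measure (Ω n))
    [∀ n, IsProbabilityMeasure (P n)]
    (ε : (n : ℕ) → Ω n → Fin n → ℝ)
    (hε_indep : ∀ n, iIndepFun (fun i ω => ε n ω i) (P n))
    (hε_law : ∀ n i, HasLaw (fun ω => ε n ω i) (gaussianReal 0 (σ ^ 2)) (P n))
    -- the initial estimator, independent of the target data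
    (βt : (n : ℕ) → Ω n → EuclideanSpace ℝ (Fin p))
    (hβt : ∀ n, AEMeasurable (βt n) (P n))
    (hβtε : ∀ n, IndepFun (βt n) (ε n) (P n))
    -- the limit variables `W ∼ N(0, σ² C)` and `z`, independent of each other
    {Ω' : Type*} [MeasurableSpace Ω'] (Q : Measure Ω') [IsProbabilityMeasure Q]
    (W z : Ω' → EuclideanSpace ℝ (Fin p))
    (hW : HasLaw W (multivariateGaussian 0 (((σ : ℝ) ^ 2) • C)) Q)
    (hWz : IndepFun W z Q)
    (hz : TendstoInDistribution
      (fun n ω => √(m n : ℝ) • (βt n ω - βs)) atTop z P Q)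
    -- an Adaptive Lasso estimator for the response `y = X βs + ε`
    (βh : (n : ℕ) → Ω n → EuclideanSpace ℝ (Fin p))
    (hβh_meas : ∀ n, AEMeasurable (βh n) (P n))
    (hβh : ∀ n, ∀ᵐ ω ∂(P n), AdaptiveLasso.IsArgmin
      (AdaptiveLasso.objective (X n) (X n *ᵥ βs.ofLp + ε n ω) (lam n) γ (βt n ω))
      Set.univ (βh n ω)) :
    -- (i)
    (∀ lam₁ : ℝ, 0 ≤ lam₁ →
      (lam₁ = 0 → ∀ j, j ∉ AdaptiveLasso.activeSet βs → ∀ᵐ ω ∂Q, z ω j ≠ 0) →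
      Tendsto (fun n : ℕ => √((m n : ℝ) ^ γ / (n : ℝ)) * lam n) atTop (𝓝 lam₁) →
      ∃ U : Ω' → EuclideanSpace ℝ (Fin p),
        (∀ᵐ ω ∂Q, AdaptiveLasso.IsUniqueArgmin
          (AdaptiveLasso.limitSmall C βs lam₁ γ (W ω) (z ω)) Set.univ (U ω)) ∧
        TendstoInDistribution (fun (n : ℕ) ω => √(n : ℝ) • (βh n ω - βs)) atTop U P Q) ∧
    -- (ii)
    (∀ lam₀ : ℝ, 0 ≤ lam₀ →
      Tendsto (fun n : ℕ => √((m n : ℝ) ^ γ / (n : ℝ)) * lam n) atTop atTop →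
      Tendsto (fun n : ℕ => lam n / √(n : ℝ)) atTop (𝓝 lam₀) →
      ∃ U : Ω' → EuclideanSpace ℝ (Fin p),
        (∀ᵐ ω ∂Q, AdaptiveLasso.IsUniqueArgmin
          (fun u => AdaptiveLasso.quad C (W ω) u + lam₀ * AdaptiveLasso.activeDrift βs γ u)
          (AdaptiveLasso.activeSubspace βs) (U ω)) ∧
        TendstoInDistribution (fun (n : ℕ) ω => √(n : ℝ) • (βh n ω - βs)) atTop U P Q) ∧
    -- (iii)
    (Tendsto (fun n : ℕ => lam n / √(n : ℝ)) atTop atTop →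
      Tendsto (fun n : ℕ => lam n / (n : ℝ)) atTop (𝓝 0) →
      ∃ u₀ : EuclideanSpace ℝ (Fin p),
        AdaptiveLasso.IsUniqueArgmin
          (fun u => AdaptiveLasso.quad C 0 u + AdaptiveLasso.activeDrift βs γ u)
          (AdaptiveLasso.activeSubspace βs) u₀ ∧
        TendstoInDistribution (fun (n : ℕ) ω => ((n : ℝ) / lam n) • (βh n ω - βs)) atTop
          (fun _ => u₀) P Q) := by
  have hm_top := AdaptiveLasso.tendsto_natCast_atTop_of_div hm hr₀ hmr
  refine ⟨fun lam₁ hlam₁ hz₀ hlim => ?_, fun lam₀ hlam₀ hlim hlim₀ => ?_, fun hlim hlim₀ => ?_⟩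
  · have key := AdaptiveLasso.tendstoInDistribution_of_scaling βs σ γ hγ X C hC hXC m hm hm_top lam
      hlam P ε hε_indep hε_law βt hβtε Q W z hW hWz hz βh hβh_meas hβh (fun n => (√(n : ℝ))⁻¹)
      AdaptiveLasso.eventually_inv_sqrt_natCast_pos AdaptiveLasso.tendsto_inv_sqrt_natCast
      (κ₀ := 0) (r₁ := 1)
      (by simpa only [AdaptiveLasso.natCast_mul_inv_sqrt] using
        AdaptiveLasso.tendsto_div_sqrt_zero hγ hm_top hlim)
      AdaptiveLasso.tendsto_inv_sqrt_mul_inv_sqrt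
      (fun s => ENNReal.ofReal lam₁ * AdaptiveLasso.weight γ s) ?_ ?_
    · refine ⟨_, Eventually.of_forall fun ω => ?_, by simpa only [inv_inv] using key⟩
      refine AdaptiveLasso.limitSmall_isUniqueArgmin (α := fun j =>
        0 * (Real.sign (βs j) / |βs j| ^ γ)) (fun _ => zero_mul _) ?_
      have h := AdaptiveLasso.limitArgmin_spec hC (AdaptiveLasso.activeSet βs)
        (fun j => 0 * (Real.sign (βs j) / |βs j| ^ γ)) ((1 : ℝ) • W ω)
        fun j => ENNReal.ofReal lam₁ * AdaptiveLasso.weight γ (z ω j)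
      rwa [one_smul] at h ⊢
    · rcases hlam₁.eq_or_lt with h | h
      · simpa [← h] using continuous_const
      · exact ENNReal.continuous_const_mul ENNReal.ofReal_ne_top |>.comp
          (AdaptiveLasso.continuous_weight γ)
    · intro j hj
      have hs : ∀ᵐ ω ∂Q, ENNReal.ofReal lam₁ ≠ 0 ∨ z ω j ≠ 0 := by
        rcases hlam₁.eq_or_lt with h | h
        · exact (hz₀ h.symm j hj).mono fun ω hω => Or.inr hω
        · exact Eventually.of_forall fun ω => Or.inl (by simpa using h)
      filter_upwards [hs] with ω hω
      simpa only [AdaptiveLasso.natCast_mul_inv_sqrt] using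
        AdaptiveLasso.tendsto_weight_scaled hγ hm hlam (ENNReal.tendsto_ofReal hlim) hω
  · have key := AdaptiveLasso.tendstoInDistribution_of_scaling βs σ γ hγ X C hC hXC m hm hm_top lam
      hlam P ε hε_indep hε_law βt hβtε Q W z hW hWz hz βh hβh_meas hβh (fun n => (√(n : ℝ))⁻¹)
      AdaptiveLasso.eventually_inv_sqrt_natCast_pos AdaptiveLasso.tendsto_inv_sqrt_natCast
      (κ₀ := lam₀) (r₁ := 1)
      (by simpa only [AdaptiveLasso.natCast_mul_inv_sqrt] using hlim₀)
      AdaptiveLasso.tendsto_inv_sqrt_mul_inv_sqrt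
      (fun _ => ∞) continuous_const fun j _ => Eventually.of_forall fun ω => ?_
    · refine ⟨_, Eventually.of_forall fun ω => ?_, by simpa only [inv_inv] using key⟩
      have h := AdaptiveLasso.limitArgmin_spec hC (AdaptiveLasso.activeSet βs)
        (fun j => lam₀ * (Real.sign (βs j) / |βs j| ^ γ)) ((1 : ℝ) • W ω) fun _ => ∞
      rw [AdaptiveLasso.penalized_top, AdaptiveLasso.feasible_top] at h
      rwa [one_smul] at h ⊢
    -- Here `L = ∞`, and weights never vanish, so every inactive weight tends to `∞` whatever the
    -- value of `z ω j`.
    · have h := AdaptiveLasso.tendsto_weight_scaled hγ hm hlam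
        (ENNReal.tendsto_ofReal_atTop.comp hlim) (s := z ω j) (Or.inl ENNReal.top_ne_zero)
      rw [ENNReal.top_mul (AdaptiveLasso.weight_ne_zero hγ _)] at h
      simpa only [AdaptiveLasso.natCast_mul_inv_sqrt] using h
  · have hlam_pos : ∀ᶠ n : ℕ in atTop, 0 < lam n ∧ (0 : ℝ) < n := by
      filter_upwards [hlim.eventually_gt_atTop 0, eventually_gt_atTop 0] with n h hn
      have hn' : (0 : ℝ) < n := by exact_mod_cast hn
      exact ⟨(div_pos_iff_of_pos_right (Real.sqrt_pos.2 hn')).1 h, hn'⟩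
    have hκ : ∀ᶠ n : ℕ in atTop, lam n / (n * (lam n / n)) = 1 := by
      filter_upwards [hlam_pos] with n ⟨h, hn⟩
      field_simp
    -- The step `t = lam n / n` normalizes `κ` to `1`, while the noise factor `√n / lam n` tends to
    -- `0`, so the limit is deterministic.
    have key := AdaptiveLasso.tendstoInDistribution_of_scaling βs σ γ hγ X C hC hXC m hm hm_top lam
      hlam P ε hε_indep hε_law βt hβtε Q W z hW hWz hz βh hβh_meas hβh (fun n => lam n / n)
      (hlam_pos.mono fun n h => div_pos h.1 h.2) hlim₀ (κ₀ := 1) (r₁ := 0)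
      (tendsto_const_nhds.congr' (hκ.mono fun n h => h.symm)) ?_
      (fun _ => ∞) continuous_const fun j _ => Eventually.of_forall fun ω => ?_
    · refine ⟨_, ?_, by simpa only [inv_div, zero_smul] using key⟩
      have h := AdaptiveLasso.limitArgmin_spec hC (AdaptiveLasso.activeSet βs)
        (fun j => 1 * (Real.sign (βs j) / |βs j| ^ γ)) 0 fun _ => ∞
      rw [AdaptiveLasso.penalized_top, AdaptiveLasso.feasible_top] at h
      simpa only [one_mul] using h
    · refine hlim.inv_tendsto_atTop.congr' ?_
      filter_upwards [hlam_pos] with n ⟨h, hn⟩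
      simp only [Pi.inv_apply]
      rw [inv_inj, mul_div_left_comm, Real.sqrt_div_self', mul_one_div]
    -- As `κ = 1` eventually, the inactive weights tend to `weight γ 0 = ∞` by continuity alone,
    -- with no rate condition.
    · have hμ : Tendsto (fun n => (√(m n : ℝ))⁻¹) atTop (𝓝 0) :=
        (Real.tendsto_sqrt_atTop.comp hm_top).inv_tendsto_atTop
      have h0 : Tendsto (fun q : ℕ × ℝ => (√(m q.1 : ℝ))⁻¹ * q.2) (atTop ×ˢ 𝓝 (z ω j)) (𝓝 0) := by
        simpa using (hμ.comp tendsto_fst).mul (tendsto_snd (f := atTop) (g := 𝓝 (z ω j)))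
      have h1 := ((AdaptiveLasso.continuous_weight γ).tendsto 0).comp h0
      rw [AdaptiveLasso.weight_zero hγ] at h1
      refine h1.congr' ?_
      filter_upwards [tendsto_fst.eventually hκ] with q hq
      rw [hq, ENNReal.ofReal_one, one_mul, Function.comp_apply]
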